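/- Let $\mathcal{D}$ be an (essentially small) $\mathbb{C}$-linear triangulated category of finite type, i.e. $\bigoplus_i \mathrm{Hom}(E,F[i])$ is finite-dimensional for all objects $E,F$, which is Calabi--Yau of dimension $n\in\mathbb{N}$, i.e. there are isomorphisms $\mathrm{Hom}(E,F)\cong\mathrm{Hom}(F,E[n])^\vee$ natural in $E$ and $F$. Let $\chi(E,F)=\sum_i(-1)^i\dim\mathrm{Hom}(E,F[i])$ be the Euler form, let $\mathcal{N}(\mathcal{D})$ be the quotient of the Grothendieck group $K(\mathcal{D})$ by the null space of $\chi$, and assume that $\mathcal{N}(\mathcal{D})$ has finite rank, with basis $\{E_i\}$. Put $$\mathfrak{b}(Z_1,Z_2)=\sum_{i,j}\chi^{i,j}Z_1(E_i)Z_2(E_j),\qquad (\chi^{i,j})=(\chi(E_i,E_j))^{-1},$$ for $Z_1,Z_2\in\mathrm{Hom}(\mathcal{N}(\mathcal{D}),\mathbb{C})$. Let $\mathrm{Stab}_{\mathcal N}(\mathcal{D})$ be the space of numerical Bridgeland stability conditions $\sigma=(Z,\mathcal{P})$ with the support property, with Bridgeland's topology and the complex structure in which the central charge $Z$ is a local coordinate,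 and let $$\mathrm{Stab}^+_{\mathcal N}(\mathcal{D})=\{(Z,\mathcal{P}) : \mathfrak{b}(Z,Z)=0,\ (\sqrt{-1})^{-n}\,\mathfrak{b}(Z,\overline{Z})>0\}.$$ The group $\mathbb{C}$ acts on it by $c\cdot(Z,\mathcal{P})=(e^cZ,\mathcal{P}')$, $\mathcal{P}'(\phi)=\mathcal{P}(\phi-\mathrm{Im}(c)/\pi)$, and the group $\mathrm{Aut}(\mathcal{D})$ of exact $\mathbb{C}$-linear autoequivalences acts by $\Phi\cdot(Z,\mathcal{P})=(Z\circ\Phi^{-1},\Phi(\mathcal{P}))$. For a local holomorphic section $s$ of $\mathrm{Stab}^+_{\mathcal N}(\mathcal{D})\to\mathrm{Stab}^+_{\mathcal N}(\mathcal{D})/\mathbb{C}$, with central charges $Z_{\bar\sigma}$, define $$K_{\mathrm{WP}}(\bar\sigma)=-\log\big((\sqrt{-1})^{-n}\,\mathfrak{b}(Z_{\bar\sigma},\overline{Z_{\bar\sigma}})\big).$$ Then $K_{\mathrm{WP}}$ is smooth in holomorphic charts, and its complex Hessian $\frac{\sqrt{-1}}{2}\partial\overline\partial K_{\mathrm{WP}}$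 does not depend on the choice of $s$: any two local holomorphic sections give the same form on the intersection of their domains, so that there is a unique smooth $(1,1)$-form $\omega$ on $\mathrm{Stab}^+_{\mathcal N}(\mathcal{D})/\mathbb{C}$ which equals $\frac{\sqrt{-1}}{2}\partial\overline\partial K_{\mathrm{WP}}$ on the domain of every local holomorphic section. Moreover, each $\Phi\in\mathrm{Aut}(\mathcal{D})$ acts holomorphically on $\mathrm{Stab}^+_{\mathcal N}(\mathcal{D})/\mathbb{C}$ with $\Phi^*\omega=\omega$, and $\omega$ descends to the double quotient $\mathrm{Aut}(\mathcal{D})\backslash\mathrm{Stab}^+_{\mathcal N}(\mathcal{D})/\mathbb{C}$ away from its singular locus: on the largest open subset of the double quotient over which the projection $q$ from $\mathrm{Stab}^+_{\mathcal N}(\mathcal{D})/\mathbb{C}$ is a local homeomorphism, with the complex structure that makes $q$ locally biholomorphic there, there is a unique smooth $(1,1)$-form $\omega_0$ with $q^*\omega_0=\omega$. -/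

import Mathlib

open CategoryTheory CategoryTheory.Limits CategoryTheory.Pretriangulated
open scoped DirectSum TensorProduct Topology ContDiff

universe v u

namespace StabWP

noncomputable section

set_option linter.unusedSectionVars false

section Euler

/-- Alternating sums of dimensions are additive in long exact sequences. -/
theorem altSum_of_exact {A B C : ℤ → Type*}
    [∀ i, AddCommGroup (A i)] [∀ i, AddCommGroup (B i)] [∀ i, AddCommGroup (C i)]
    [∀ i, Module ℂ (A i)] [∀ i, Module ℂ (B i)] [∀ i, Module ℂ (C i)]
    [∀ i, Module.Finite ℂ (A i)] [∀ i, Module.Finite ℂ (B i)] [∀ i, Module.Finite ℂ (C i)]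
    (f : ∀ i, A i →ₗ[ℂ] B i) (g : ∀ i, B i →ₗ[ℂ] C i) (h : ∀ i, C i →ₗ[ℂ] A (i + 1))
    (hfg : ∀ i, LinearMap.range (f i) = LinearMap.ker (g i))
    (hgh : ∀ i, LinearMap.range (g i) = LinearMap.ker (h i))
    (hhf : ∀ i, LinearMap.range (h i) = LinearMap.ker (f (i + 1)))
    (sA : {i | Module.finrank ℂ (A i) ≠ 0}.Finite)
    (sC : {i | Module.finrank ℂ (C i) ≠ 0}.Finite) :
    ∑ᶠ i : ℤ, (i.negOnePow : ℤ) * (Module.finrank ℂ (B i) : ℤ)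
      = ∑ᶠ i : ℤ, (i.negOnePow : ℤ) * (Module.finrank ℂ (A i) : ℤ)
        + ∑ᶠ i : ℤ, (i.negOnePow : ℤ) * (Module.finrank ℂ (C i) : ℤ) := by
  set r : ℤ → ℤ := fun i => (Module.finrank ℂ (LinearMap.range (h i)) : ℤ) with hr
  set w : ℤ → ℤ := fun i => (i.negOnePow : ℤ) * r i with hw
  have hC : ∀ i, r i ≤ Module.finrank ℂ (C i) := fun i => by
    simp only [hr]; exact_mod_cast (h i).finrank_range_le
  have sw : w.support.Finite := by
    refine sC.subset fun i hi => ?_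
    simp only [Set.mem_ofPred_eq]
    intro h0
    have h1 := hC i
    have h2 : 0 ≤ r i := by simp [hr]
    apply hi
    have h3 : r i = 0 := by rw [h0] at h1; push_cast at h1; omega
    simp [hw, h3]
  have sw' : (fun i => w (i - 1)).support.Finite := by
    have : (fun i => w (i - 1)).support = (fun i => i + 1) '' w.support := by
      ext i
      constructor
      · intro hi; exact ⟨i - 1, hi, by simp⟩
      · rintro ⟨j, hj, rfl⟩; simpa using hj
    rw [this]; exact sw.image _
  have sA' : (fun i : ℤ => (i.negOnePow : ℤ) * (Module.finrank ℂ (A i) : ℤ)).support.Finite :=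
    sA.subset fun i hi => by
      simp only [Set.mem_ofPred_eq]; intro h0; apply hi; simp [h0]
  have sC' : (fun i : ℤ => (i.negOnePow : ℤ) * (Module.finrank ℂ (C i) : ℤ)).support.Finite :=
    sC.subset fun i hi => by
      simp only [Set.mem_ofPred_eq]; intro h0; apply hi; simp [h0]
  have key : ∀ i : ℤ, (i.negOnePow : ℤ) * (Module.finrank ℂ (B i) : ℤ)
      = ((i.negOnePow : ℤ) * (Module.finrank ℂ (A i) : ℤ)
        + (i.negOnePow : ℤ) * (Module.finrank ℂ (C i) : ℤ)) - (w i - w (i - 1)) := by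
    intro i
    have e1 := (g i).finrank_range_add_finrank_ker
    rw [← hfg] at e1
    have e2 := (h i).finrank_range_add_finrank_ker
    rw [← hgh] at e2
    have e3 : Module.finrank ℂ (LinearMap.range (f i))
        + Module.finrank ℂ (LinearMap.range (h (i - 1))) = Module.finrank ℂ (A i) := by
      obtain ⟨j, rfl⟩ : ∃ j, i = j + 1 := ⟨i - 1, by simp⟩
      have e3 := (f (j + 1)).finrank_range_add_finrank_ker
      rw [← hhf] at e3
      have : j + 1 - 1 = j := by simp
      rw [this]; exact e3
    have e4 : (i - 1).negOnePow = - i.negOnePow := by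
      rw [Int.negOnePow_sub]; simp
    simp only [hw, hr, e4]
    rw [← e1, ← e2, ← e3]
    push_cast
    ring
  rw [finsum_congr key, finsum_sub_distrib _ _ , finsum_add_distrib sA' sC', finsum_sub_distrib sw sw']
  · have : ∑ᶠ i, w (i - 1) = ∑ᶠ i, w i := finsum_comp_equiv (Equiv.subRight (1 : ℤ)) (f := w)
    rw [this]; ring
  · exact (sA'.union sC').subset (Function.support_add _ _)
  · exact (sw.union sw').subset (Function.support_sub _ _)

end Euler

section ComplexGeometry

/-- The Wirtinger derivative `∂f/∂zⱼ = (∂f/∂xⱼ - √-1 ∂f/∂yⱼ)/2`. -/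
def wirtinger {m : ℕ} (j : Fin m) (f : (Fin m → ℂ) → ℂ) (w : Fin m → ℂ) : ℂ :=
  (fderiv ℝ f w (Pi.single j 1) - Complex.I * fderiv ℝ f w (Pi.single j Complex.I)) / 2

/-- The Wirtinger derivative `∂f/∂z̄ⱼ = (∂f/∂xⱼ + √-1 ∂f/∂yⱼ)/2`. -/
def wirtingerBar {m : ℕ} (j : Fin m) (f : (Fin m → ℂ) → ℂ) (w : Fin m → ℂ) : ℂ :=
  (fderiv ℝ f w (Pi.single j 1) + Complex.I * fderiv ℝ f w (Pi.single j Complex.I)) / 2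

/-- The coefficient matrix `∂²K/∂zⱼ∂z̄ₖ` of the form
`(√-1/2) ∂∂̄K = (√-1/2) ∑ (∂²K/∂zⱼ∂z̄ₖ) dzⱼ ∧ dz̄ₖ`. -/
def complexHessian {m : ℕ} (K : (Fin m → ℂ) → ℝ) (w : Fin m → ℂ) : Matrix (Fin m) (Fin m) ℂ :=
  Matrix.of fun j k => wirtinger j (wirtingerBar k fun v => (K v : ℂ)) w

/-- The complex Jacobian matrix `∂gᵢ/∂zⱼ`. -/
def jacobian {m m' : ℕ} (g : (Fin m → ℂ) → (Fin m' → ℂ)) (w : Fin m → ℂ) :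
    Matrix (Fin m') (Fin m) ℂ :=
  Matrix.of fun i j => fderiv ℂ g w (Pi.single j 1) i

/-- A collection of complex charts on a topological space. -/
abbrev ChartFamily (Y : Type*) [TopologicalSpace Y] : Type _ :=
  ∀ m : ℕ, Set (OpenPartialHomeomorph Y (Fin m → ℂ))

/-- Coefficient matrices in each chart. The matrix `a` at a point stands for the `(1,1)`-form
`(√-1/2) ∑ aⱼₖ dzⱼ ∧ dz̄ₖ` there. -/
abbrev Coefficients {Y : Type*} [TopologicalSpace Y] (A : ChartFamily Y) : Type _ :=
  ∀ m : ℕ, ∀ c ∈ A m, (Fin m → ℂ) → Matrix (Fin m) (Fin m) ℂ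

/-- The map `g` is holomorphic at `y` in all charts, and the form with coefficients `a` is at `y`
the pullback under `g` of the form with coefficients `a'`. -/
def IsPullbackAt {Y Y' : Type*} [TopologicalSpace Y] [TopologicalSpace Y']
    {A : ChartFamily Y} {A' : ChartFamily Y'} (g : Y → Y') (a' : Coefficients A')
    (a : Coefficients A) (y : Y) : Prop :=
  ∀ (m m' : ℕ) (c : OpenPartialHomeomorph Y (Fin m → ℂ))
    (c' : OpenPartialHomeomorph Y' (Fin m' → ℂ)) (hc : c ∈ A m) (hc' : c' ∈ A' m'),
    y ∈ c.source → g y ∈ c'.source →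
    DifferentiableAt ℂ (fun v => c' (g (c.symm v))) (c y) ∧
    a m c hc (c y) =
      (jacobian (fun v => c' (g (c.symm v))) (c y)).transpose * a' m' c' hc' (c' (g y)) *
        (jacobian (fun v => c' (g (c.symm v))) (c y)).map (starRingEnd ℂ)

/-- A smooth `(1,1)`-form: smooth coefficients in every chart (set to zero outside the image of the
chart), compatible under holomorphic changes of charts. -/
@[ext]
structure OneOneForm {Y : Type*} [TopologicalSpace Y] (A : ChartFamily Y) where
  coeff : Coefficients A
  eq_zero : ∀ m c (hc : c ∈ A m), ∀ w ∉ c.target, coeff m c hc w = 0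
  smooth : ∀ m c (hc : c ∈ A m) (j k : Fin m),
    ContDiffOn ℝ ∞ (fun w => coeff m c hc w j k) c.target
  compatible : ∀ y, IsPullbackAt id coeff coeff y

end ComplexGeometry

section Category

variable (D : Type u) [Category.{v} D] [HasZeroObject D] [HasShift D ℤ] [Preadditive D]
  [∀ n : ℤ, (shiftFunctor D n).Additive] [Pretriangulated D] [Linear ℂ D]

/-- `D` is of finite type: the graded vector space `⨁ᵢ Hom(E, F[i])` is finite-dimensional for all
objects `E` and `F`. -/
class FiniteType : Prop where
  finite : ∀ E F : D, Module.Finite ℂ (⨁ i : ℤ, (E ⟶ F⟦i⟧))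

variable {D}

instance FiniteType.finite_hom [FiniteType D] (E F : D) (i : ℤ) : Module.Finite ℂ (E ⟶ F⟦i⟧) := by
  have := FiniteType.finite E F
  exact Module.Finite.of_surjective (DirectSum.component ℂ ℤ (fun i : ℤ => (E ⟶ F⟦i⟧)) i)
    (fun x => ⟨DirectSum.lof ℂ ℤ _ i x, DirectSum.component.lof_self ..⟩)

theorem FiniteType.finite_support [FiniteType D] (E F : D) :
    {i : ℤ | Module.finrank ℂ (E ⟶ F⟦i⟧) ≠ 0}.Finite := by
  classical
  have := FiniteType.finite E F
  obtain ⟨s, hs⟩ := (this.fg_top : (⊤ : Submodule ℂ (⨁ i : ℤ, (E ⟶ F⟦i⟧))).FG)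
  refine (s.biUnion fun x => DFinsupp.support x).finite_toSet.subset fun i hi => ?_
  by_contra hn
  apply hi
  have h0 : DirectSum.component ℂ ℤ (fun i : ℤ => (E ⟶ F⟦i⟧)) i = 0 := by
    refine LinearMap.ext_on (s := (s : Set _)) hs fun x hx => ?_
    by_contra h1
    apply hn
    simp only [Finset.coe_biUnion, Set.mem_iUnion]
    exact ⟨x, hx, by simp only [Finset.mem_coe, DFinsupp.mem_support_toFun]; exact h1⟩
  have : Subsingleton (E ⟶ F⟦i⟧) := by
    refine subsingleton_of_forall_eq 0 fun x => ?_
    have := LinearMap.congr_fun h0 (DirectSum.lof ℂ ℤ _ i x)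
    rwa [DirectSum.component.lof_self] at this
  exact Module.finrank_zero_of_subsingleton

/-- The Euler pairing `∑ᵢ (-1)ⁱ dim Hom(E, F[i])` of two objects. -/
def eulerObj (E F : D) : ℤ :=
  ∑ᶠ i : ℤ, (i.negOnePow : ℤ) * (Module.finrank ℂ (E ⟶ F⟦i⟧) : ℤ)

theorem eulerObj_add_right [FiniteType D] (E : D) (T : Triangle D) (hT : T ∈ distTriang D) :
    eulerObj E T.obj₂ = eulerObj E T.obj₁ + eulerObj E T.obj₃ := by
  let G := preadditiveCoyoneda.obj (Opposite.op E)
  have e₂ (i : ℤ) := (ShortComplex.ab_exact_iff_function_exact _).1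
    (G.homologySequence_exact₂ T hT i)
  have e₃ (i : ℤ) := (ShortComplex.ab_exact_iff_function_exact _).1
    (G.homologySequence_exact₃ T hT i (i + 1) rfl)
  have e₁ (i : ℤ) := (ShortComplex.ab_exact_iff_function_exact _).1
    (G.homologySequence_exact₁ T hT i (i + 1) rfl)
  have hδ (i : ℤ) (x : E ⟶ T.obj₃⟦i⟧) := preadditiveCoyoneda_homologySequenceδ_apply
    T i (i + 1) rfl (A := Opposite.op E) x
  refine altSum_of_exact (A := fun i => (E ⟶ T.obj₁⟦i⟧)) (B := fun i => (E ⟶ T.obj₂⟦i⟧))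
    (C := fun i => (E ⟶ T.obj₃⟦i⟧))
    (fun i => Linear.rightComp ℂ E (T.mor₁⟦i⟧')) (fun i => Linear.rightComp ℂ E (T.mor₂⟦i⟧'))
    (fun i => Linear.rightComp ℂ E
      (T.mor₃⟦i⟧' ≫ (shiftFunctorAdd' D 1 i (i + 1) (add_comm _ _)).inv.app _)) ?_ ?_ ?_
    (FiniteType.finite_support _ _) (FiniteType.finite_support _ _)
  · intro i
    ext x
    exact (e₂ i x).symm
  · intro i
    ext x
    refine Iff.trans (e₃ i x).symm ?_
    exact Eq.congr_left (hδ i x)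
  · intro i
    ext x
    refine Iff.trans ?_ (e₁ i x).symm
    exact exists_congr fun y => Eq.congr_left (hδ i y).symm

theorem eulerObj_add_left [FiniteType D] [∀ n : ℤ, (shiftFunctor D n).Linear ℂ]
    (F : D) (T : Triangle D) (hT : T ∈ distTriang D) :
    eulerObj T.obj₂ F = eulerObj T.obj₁ F + eulerObj T.obj₃ F := by
  let a (i : ℤ) : (F⟦i⟧)⟦(1 : ℤ)⟧ ≅ F⟦i + 1⟧ := ((shiftFunctorAdd D i 1).app F).symm
  rw [add_comm]
  refine altSum_of_exact (A := fun i => (T.obj₃ ⟶ F⟦i⟧)) (B := fun i => (T.obj₂ ⟶ F⟦i⟧))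
    (C := fun i => (T.obj₁ ⟶ F⟦i⟧))
    (fun i => Linear.leftComp ℂ _ T.mor₂) (fun i => Linear.leftComp ℂ _ T.mor₁)
    (fun i => (Linear.leftComp ℂ _ T.mor₃) ∘ₗ (Linear.rightComp ℂ _ (a i).hom) ∘ₗ
      (Functor.mapLinearMap ℂ (shiftFunctor D (1 : ℤ)))) ?_ ?_ ?_
    (FiniteType.finite_support _ _) (FiniteType.finite_support _ _)
  · intro i
    ext x
    constructor
    · rintro ⟨y, rfl⟩
      show T.mor₁ ≫ T.mor₂ ≫ y = 0
      rw [← Category.assoc, comp_distTriang_mor_zero₁₂ _ hT, zero_comp]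
    · intro hx
      obtain ⟨y, hy⟩ := Triangle.yoneda_exact₂ _ hT x hx
      exact ⟨y, hy.symm⟩
  · intro i
    ext x
    constructor
    · rintro ⟨y, rfl⟩
      show T.mor₃ ≫ (shiftFunctor D (1 : ℤ)).map (T.mor₁ ≫ y) ≫ (a i).hom = 0
      rw [Functor.map_comp, Category.assoc, ← Category.assoc, comp_distTriang_mor_zero₃₁ _ hT,
        zero_comp]
    · intro (hx : T.mor₃ ≫ (shiftFunctor D (1 : ℤ)).map x ≫ (a i).hom = 0)
      rw [← Category.assoc, ← cancel_mono (a i).inv, zero_comp, Category.assoc,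
        Iso.hom_inv_id, Category.comp_id] at hx
      obtain ⟨y, hy⟩ := Triangle.yoneda_exact₃ _ (rot_of_distTriang _ hT) _ hx
      have hy : (shiftFunctor D (1 : ℤ)).map x = (-(shiftFunctor D (1 : ℤ)).map T.mor₁) ≫ y := hy
      obtain ⟨z, rfl⟩ : ∃ z : T.obj₂ ⟶ F⟦i⟧, (shiftFunctor D (1 : ℤ)).map z = y :=
        (shiftFunctor D (1 : ℤ)).map_surjective y
      refine ⟨-z, ?_⟩
      apply (shiftFunctor D (1 : ℤ)).map_injective
      rw [hy]
      show (shiftFunctor D (1 : ℤ)).map (T.mor₁ ≫ (-z)) = _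
      rw [Functor.map_comp, Functor.map_neg, Preadditive.comp_neg, Preadditive.neg_comp]
  · intro i
    ext x
    constructor
    · rintro ⟨y, rfl⟩
      show T.mor₂ ≫ T.mor₃ ≫ (shiftFunctor D (1 : ℤ)).map y ≫ (a i).hom = 0
      rw [← Category.assoc, comp_distTriang_mor_zero₂₃ _ hT, zero_comp]
    · intro hx
      obtain ⟨y, hy⟩ := Triangle.yoneda_exact₃ _ hT x hx
      obtain ⟨z, hz⟩ := (shiftFunctor D (1 : ℤ)).map_surjective (y ≫ (a i).inv)
      refine ⟨z, ?_⟩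
      show T.mor₃ ≫ (shiftFunctor D (1 : ℤ)).map z ≫ (a i).hom = x
      rw [hz, Category.assoc, Iso.inv_hom_id, Category.comp_id, hy]


variable [FiniteType D] [∀ n : ℤ, (shiftFunctor D n).Linear ℂ]

variable (D) in
/-- The subgroup of relations `[B] = [A] + [C]`, one for each exact triangle `A → B → C → A[1]`. -/
def triangleRelations : AddSubgroup (FreeAbelianGroup D) :=
  AddSubgroup.closure {x | ∃ T ∈ distTriang D,
    x = FreeAbelianGroup.of T.obj₂ - (FreeAbelianGroup.of T.obj₁ + FreeAbelianGroup.of T.obj₃)}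

variable (D) in
/-- The Grothendieck group `K(D)`. -/
abbrev K0 : Type u := FreeAbelianGroup D ⧸ triangleRelations D

/-- The class of an object in `K(D)`. -/
def K0.of (E : D) : K0 D := QuotientAddGroup.mk (FreeAbelianGroup.of E)

/-- Additive functions on objects extend to `K(D)`. -/
def K0.lift {A : Type*} [AddCommGroup A] (f : D → A)
    (hf : ∀ T ∈ distTriang D, f T.obj₂ = f T.obj₁ + f T.obj₃) : K0 D →+ A :=
  QuotientAddGroup.lift _ (FreeAbelianGroup.lift f) <| by
    refine (AddSubgroup.closure_le _).2 ?_
    rintro _ ⟨T, hT, rfl⟩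
    simp [hf T hT]

theorem K0.lift_of {A : Type*} [AddCommGroup A] (f : D → A)
    (hf : ∀ T ∈ distTriang D, f T.obj₂ = f T.obj₁ + f T.obj₃) (E : D) :
    K0.lift f hf (K0.of E) = f E := by
  exact FreeAbelianGroup.lift_apply_of f E

theorem K0.of_triangle (T : Triangle D) (hT : T ∈ distTriang D) :
    K0.of T.obj₂ = K0.of T.obj₁ + K0.of T.obj₃ := by
  have : FreeAbelianGroup.of T.obj₂ - (FreeAbelianGroup.of T.obj₁ + FreeAbelianGroup.of T.obj₃)
      ∈ triangleRelations D := AddSubgroup.subset_closure ⟨T, hT, rfl⟩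
  have h := (QuotientAddGroup.eq_zero_iff _).2 this
  rw [QuotientAddGroup.mk_sub, sub_eq_zero] at h
  exact h

theorem K0.hom_ext {A : Type*} [AddCommGroup A] {f g : K0 D →+ A}
    (h : ∀ E, f (K0.of E) = g (K0.of E)) : f = g := by
  apply QuotientAddGroup.addMonoidHom_ext
  apply FreeAbelianGroup.lift_ext
  exact h

/-- The Euler form on `K(D)`. -/
def eulerForm : K0 D →+ K0 D →+ ℤ :=
  K0.lift (fun E => K0.lift (fun F => eulerObj E F) (fun T hT => eulerObj_add_right E T hT))
    (fun T hT => K0.hom_ext fun F => by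
      simp only [AddMonoidHom.add_apply, K0.lift_of]
      exact eulerObj_add_left F T hT)

theorem eulerForm_of (E F : D) : eulerForm (K0.of E) (K0.of F) = eulerObj E F := by
  simp [eulerForm, K0.lift_of]

variable (D) in
/-- The null space of the Euler form. -/
def eulerNull : AddSubgroup (K0 D) where
  carrier := {x | ∀ y, eulerForm x y = 0 ∧ eulerForm y x = 0}
  add_mem' {a b} ha hb y := by simp [ha y, hb y]
  zero_mem' y := by simp
  neg_mem' {a} ha y := by simp [ha y]

variable (D) in
/-- The numerical Grothendieck group `N(D)`. -/
abbrev Num : Type u := K0 D ⧸ eulerNull D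

/-- The class of an object in `N(D)`. -/
def Num.of (E : D) : Num D := QuotientAddGroup.mk (K0.of E)

theorem Num.hom_ext {A : Type*} [AddCommGroup A] {f g : Num D →+ A}
    (h : ∀ E, f (Num.of E) = g (Num.of E)) : f = g :=
  QuotientAddGroup.addMonoidHom_ext _ (K0.hom_ext h)

/-- The Euler form on `N(D)`. -/
def numEuler : Num D →+ Num D →+ ℤ :=
  QuotientAddGroup.lift _
    { toFun := fun x => QuotientAddGroup.lift (eulerNull D) (eulerForm x) fun _ hy => (hy x).2
      map_zero' := QuotientAddGroup.addMonoidHom_ext _ (AddMonoidHom.ext fun y => by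
        show eulerForm 0 y = 0
        simp)
      map_add' := fun a b => QuotientAddGroup.addMonoidHom_ext _ (AddMonoidHom.ext fun y => by
        show eulerForm (a + b) y = eulerForm a y + eulerForm b y
        simp) }
    fun x hx => QuotientAddGroup.addMonoidHom_ext _ (AddMonoidHom.ext fun y => (hx y).1)

theorem numEuler_of (E F : D) : numEuler (Num.of E) (Num.of F) = eulerObj E F :=
  eulerForm_of E F

theorem K0.of_isZero {E : D} (hE : IsZero E) : K0.of E = 0 := by
  have h := K0.of_triangle (Triangle.mk (𝟙 E) (0 : E ⟶ E) (hE.to_ (E⟦(1 : ℤ)⟧)))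
    (isomorphic_distinguished _ (contractible_distinguished E) _
      (Triangle.isoMk _ _ (Iso.refl _) (Iso.refl _) hE.isoZero (hE.eq_of_src _ _)
        (hE.eq_of_src _ _) (hE.eq_of_src _ _)))
  have h : K0.of E = K0.of E + K0.of E := h
  simpa using h

theorem K0.of_iso {E F : D} (e : E ≅ F) : K0.of E = K0.of F := by
  obtain ⟨Z, g, h, hT⟩ := distinguished_cocone_triangle e.hom
  have hZ : IsZero Z := Triangle.isZero₃_of_isIso₁ _ hT (inferInstanceAs (IsIso e.hom))
  have h : K0.of F = K0.of E + K0.of Z := K0.of_triangle _ hT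
  rw [h, K0.of_isZero hZ, add_zero]

theorem Num.of_iso {E F : D} (e : E ≅ F) : Num.of E = Num.of F :=
  congrArg QuotientAddGroup.mk (K0.of_iso e)

variable (D) in
/-- `D` is a Calabi--Yau category of dimension `n`: there are isomorphisms
`Hom(E, F) ≅ Hom(F, E[n])^∨`, natural in `E` and `F`. -/
def IsCalabiYau (n : ℕ) : Prop :=
  ∃ e : ∀ E F : D, (E ⟶ F) ≃ₗ[ℂ] Module.Dual ℂ (F ⟶ E⟦(n : ℤ)⟧),
    ∀ {E' E F F' : D} (f : E' ⟶ E) (x : E ⟶ F) (g : F ⟶ F') (y : F' ⟶ E'⟦(n : ℤ)⟧),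
      e E' F' (f ≫ x ≫ g) y = e E F x (g ≫ y ≫ f⟦(n : ℤ)⟧')

/-- A Harder--Narasimhan filtration of `X` with respect to the subcategories `P φ`: exact triangles
`E i → E (i+1) → A i → E i [1]` from `0` to `X`, with `A i` in `P (φ i)` for strictly decreasing
phases `φ i`. -/
structure HNFiltration (P : ℝ → ObjectProperty D) (X : D) where
  k : ℕ
  E : Fin (k + 1) → D
  A : Fin k → D
  φ : Fin k → ℝ
  zero : IsZero (E 0)
  top : Nonempty (E (Fin.last k) ≅ X)
  triangle : ∀ i : Fin k, ∃ (f : E i.castSucc ⟶ E i.succ) (g : E i.succ ⟶ A i)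
    (h : A i ⟶ (E i.castSucc)⟦(1 : ℤ)⟧), Triangle.mk f g h ∈ distTriang D
  semistable : ∀ i, P (φ i) (A i)
  anti : StrictAnti φ

variable (D) in
/-- A numerical (Bridgeland) stability condition with the support property. -/
@[ext]
structure StabilityCondition where
  /-- the central charge -/
  Z : Num D →+ ℂ
  /-- the semistable objects of phase `φ`, a strictly full additive subcategory -/
  P : ℝ → ObjectProperty D
  iso_closed : ∀ {φ : ℝ} {X Y : D}, (X ≅ Y) → P φ X → P φ Y
  zero_mem : ∀ (φ : ℝ) (X : D), IsZero X → P φ X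
  biprod_mem : ∀ {φ : ℝ} {X Y : D}, P φ X → P φ Y → P φ (X ⊞ Y)
  phase : ∀ {φ : ℝ} {X : D}, P φ X → ¬ IsZero X →
    ∃ m : ℝ, 0 < m ∧ Z (Num.of X) = m * Complex.exp (Complex.I * (Real.pi * φ))
  shift_mem : ∀ (φ : ℝ) (X : D), P (φ + 1) (X⟦(1 : ℤ)⟧) ↔ P φ X
  hom_zero : ∀ {φ₁ φ₂ : ℝ} {A₁ A₂ : D}, φ₂ < φ₁ → P φ₁ A₁ → P φ₂ A₂ → ∀ f : A₁ ⟶ A₂, f = 0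
  hn : ∀ X : D, ¬ IsZero X → Nonempty (HNFiltration P X)
  support : ∃ C : ℝ, 0 < C ∧ ∃ q : Seminorm ℝ (ℝ ⊗[ℤ] Num D), (∀ x, q x = 0 → x = 0) ∧
    ∀ (φ : ℝ) (X : D), P φ X → q (1 ⊗ₜ Num.of X) ≤ C * ‖Z (Num.of X)‖

namespace StabilityCondition

/-- The phases of the Harder--Narasimhan factors of `X`. -/
def hnPhases (σ : StabilityCondition D) (X : D) : Set ℝ :=
  {t | ∃ H : HNFiltration σ.P X, (∀ i, ¬ IsZero (H.A i)) ∧ ∃ i, H.φ i = t}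

/-- The largest phase `φ⁺(X)` of a Harder--Narasimhan factor of `X`. -/
def phasePlus (σ : StabilityCondition D) (X : D) : ℝ := sSup (σ.hnPhases X)

/-- The smallest phase `φ⁻(X)` of a Harder--Narasimhan factor of `X`. -/
def phaseMinus (σ : StabilityCondition D) (X : D) : ℝ := sInf (σ.hnPhases X)

/-- Bridgeland's topology: the coarsest one for which the central charge is continuous, as well as
the pair `(φ⁻, φ⁺)` for uniform convergence over all nonzero objects, that is, for the generalised
metric `sup {|φ⁻_σ(X) - φ⁻_τ(X)|, |φ⁺_σ(X) - φ⁺_τ(X)| : X ≠ 0}`. -/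
instance : TopologicalSpace (StabilityCondition D) :=
  TopologicalSpace.induced (fun σ => (fun x : Num D => σ.Z x)) inferInstance ⊓
  TopologicalSpace.induced (fun σ => UniformFun.ofFun
    (fun X : {X : D // ¬ IsZero X} => (σ.phaseMinus X, σ.phasePlus X))) inferInstance

/-- The action of `ℂ`: the central charge is multiplied by `exp c`, and phases are relabelled
accordingly. -/
def rotate (c : ℂ) (σ : StabilityCondition D) : StabilityCondition D where
  Z := (AddMonoidHom.mulLeft (Complex.exp c)).comp σ.Z
  P φ := σ.P (φ - c.im / Real.pi)
  iso_closed := σ.iso_closed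
  zero_mem _ := σ.zero_mem _
  biprod_mem := σ.biprod_mem
  phase {φ X} hX h0 := by
    obtain ⟨m, hm, h⟩ := σ.phase hX h0
    refine ⟨Real.exp c.re * m, by positivity, ?_⟩
    have hpi : (Real.pi : ℂ) ≠ 0 := by exact_mod_cast Real.pi_ne_zero
    have e : c + Complex.I * (Real.pi * ((φ - c.im / Real.pi : ℝ) : ℂ))
        = c.re + Complex.I * (Real.pi * φ) := by
      have h1 : (Real.pi : ℂ) * (c.im / Real.pi) = c.im := by field_simp
      have h2 := Complex.re_add_im c
      push_cast
      linear_combination -h2 - Complex.I * h1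
    simp only [AddMonoidHom.comp_apply, AddMonoidHom.coe_mulLeft, h]
    rw [mul_left_comm, ← Complex.exp_add, e, Complex.exp_add]
    push_cast
    ring
  shift_mem φ X := by
    have := σ.shift_mem (φ - c.im / Real.pi) X
    rwa [show φ - c.im / Real.pi + 1 = φ + 1 - c.im / Real.pi by ring] at this
  hom_zero h := σ.hom_zero (by linarith)
  hn X hX := (σ.hn X hX).map fun H =>
    { H with
      φ := fun i => H.φ i + c.im / Real.pi
      semistable := fun i => by simpa using H.semistable i
      anti := fun i j h => by simpa using H.anti h }
  support := by
    obtain ⟨C, hC, q, hq, h⟩ := σ.support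
    refine ⟨C * Real.exp (-c.re), by positivity, q, hq, fun φ X hX => ?_⟩
    refine (h _ X hX).trans (le_of_eq ?_)
    simp only [AddMonoidHom.comp_apply, AddMonoidHom.coe_mulLeft, norm_mul, Complex.norm_exp]
    rw [mul_assoc, ← mul_assoc (Real.exp _) (Real.exp _), ← Real.exp_add]
    simp

instance : AddAction ℂ (StabilityCondition D) where
  vadd := rotate
  zero_vadd σ := by
    refine StabilityCondition.ext ?_ ?_
    · ext; simp [HVAdd.hVAdd, rotate]
    · simp [HVAdd.hVAdd, rotate]
  add_vadd c d σ := by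
    refine StabilityCondition.ext ?_ ?_
    · ext; simp [HVAdd.hVAdd, rotate, Complex.exp_add, mul_assoc]
    · funext φ
      show σ.P _ = σ.P _
      congr 1
      simp
      ring

end StabilityCondition

/-- An exact `ℂ`-linear autoequivalence of `D`. -/
structure ExactAuto (D : Type u) [Category.{v} D] [HasZeroObject D] [HasShift D ℤ] [Preadditive D]
    [∀ n : ℤ, (shiftFunctor D n).Additive] [Pretriangulated D] [Linear ℂ D] where
  equiv : D ≌ D
  [commShift_functor : equiv.functor.CommShift ℤ]
  [commShift_inverse : equiv.inverse.CommShift ℤ]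
  [commShift : equiv.CommShift ℤ]
  [triangulated : equiv.IsTriangulated]
  [linear : equiv.functor.Linear ℂ]

attribute [instance] ExactAuto.commShift_functor ExactAuto.commShift_inverse ExactAuto.commShift
  ExactAuto.triangulated ExactAuto.linear

namespace ExactAuto

/-- The identity autoequivalence. -/
def refl : ExactAuto D where
  equiv := CategoryTheory.Equivalence.refl
  linear := inferInstanceAs ((𝟭 D).Linear ℂ)

/-- The inverse autoequivalence. -/
def symm (Φ : ExactAuto D) : ExactAuto D where
  equiv := Φ.equiv.symm
  linear := inferInstanceAs (Φ.equiv.inverse.Linear ℂ)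

/-- The composition of two autoequivalences (first `Φ`, then `Ψ`). -/
def trans (Φ Ψ : ExactAuto D) : ExactAuto D where
  equiv := Φ.equiv.trans Ψ.equiv
  linear := inferInstanceAs ((Φ.equiv.functor ⋙ Ψ.equiv.functor).Linear ℂ)

theorem eulerObj_map (Φ : ExactAuto D) (E F : D) :
    eulerObj (Φ.equiv.functor.obj E) (Φ.equiv.functor.obj F) = eulerObj E F := by
  refine finsum_congr fun i => ?_
  have e₁ : (E ⟶ F⟦i⟧) ≃ₗ[ℂ] (Φ.equiv.functor.obj E ⟶ Φ.equiv.functor.obj (F⟦i⟧)) :=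
    LinearEquiv.ofBijective (Φ.equiv.functor.mapLinearMap ℂ)
      ⟨Φ.equiv.functor.map_injective, Φ.equiv.functor.map_surjective⟩
  have e₂ := Linear.homCongr ℂ (Iso.refl (Φ.equiv.functor.obj E))
    ((Φ.equiv.functor.commShiftIso i).app F)
  rw [(e₁.trans e₂).finrank_eq]
  rfl

/-- The automorphism of `K(D)` induced by an autoequivalence. -/
def mapK0 (Φ : ExactAuto D) : K0 D →+ K0 D :=
  K0.lift (fun E => K0.of (Φ.equiv.functor.obj E)) fun T hT =>
    K0.of_triangle _ (Φ.equiv.functor.map_distinguished T hT)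

theorem mapK0_of (Φ : ExactAuto D) (E : D) :
    Φ.mapK0 (K0.of E) = K0.of (Φ.equiv.functor.obj E) := K0.lift_of _ _ _

theorem eulerForm_mapK0 (Φ : ExactAuto D) (x y : K0 D) :
    eulerForm (Φ.mapK0 x) (Φ.mapK0 y) = eulerForm x y := by
  have h : (AddMonoidHom.compHom (AddMonoidHom.id ℤ)).comp
      ((AddMonoidHom.compHom.flip Φ.mapK0).comp (eulerForm.comp Φ.mapK0)) = eulerForm :=
    K0.hom_ext fun E => K0.hom_ext fun F => by
      show eulerForm (Φ.mapK0 (K0.of E)) (Φ.mapK0 (K0.of F)) = _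
      rw [mapK0_of, mapK0_of, eulerForm_of, eulerForm_of, eulerObj_map]
  exact DFunLike.congr_fun (DFunLike.congr_fun h x) y

theorem mapK0_symm (Φ : ExactAuto D) (x : K0 D) : Φ.mapK0 (Φ.symm.mapK0 x) = x := by
  have h : Φ.mapK0.comp Φ.symm.mapK0 = AddMonoidHom.id _ := K0.hom_ext fun E => by
    simp only [AddMonoidHom.comp_apply, mapK0_of]
    exact K0.of_iso (Φ.equiv.counitIso.app E)
  exact DFunLike.congr_fun h x

/-- The automorphism of `N(D)` induced by an autoequivalence. -/
def mapNum (Φ : ExactAuto D) : Num D →+ Num D :=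
  QuotientAddGroup.map _ _ Φ.mapK0 fun x hx y => by
    rw [← Φ.mapK0_symm y, eulerForm_mapK0, eulerForm_mapK0]
    exact hx _

theorem mapNum_of (Φ : ExactAuto D) (E : D) :
    Φ.mapNum (Num.of E) = Num.of (Φ.equiv.functor.obj E) :=
  congrArg QuotientAddGroup.mk (Φ.mapK0_of E)

theorem mapNum_symm (Φ : ExactAuto D) (x : Num D) : Φ.mapNum (Φ.symm.mapNum x) = x := by
  have h : Φ.mapNum.comp Φ.symm.mapNum = AddMonoidHom.id _ := Num.hom_ext fun E => by
    simp only [AddMonoidHom.comp_apply, mapNum_of]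
    exact Num.of_iso (Φ.equiv.counitIso.app E)
  exact DFunLike.congr_fun h x

theorem numEuler_mapNum (Φ : ExactAuto D) (x y : Num D) :
    numEuler (Φ.mapNum x) (Φ.mapNum y) = numEuler x y := by
  obtain ⟨x, rfl⟩ := QuotientAddGroup.mk_surjective x
  obtain ⟨y, rfl⟩ := QuotientAddGroup.mk_surjective y
  exact Φ.eulerForm_mapK0 x y

end ExactAuto

namespace StabilityCondition

/-- The action of autoequivalences: `Φ · (Z, P) = (Z ∘ Φ⁻¹, Φ(P))`. -/
def act (Φ : ExactAuto D) (σ : StabilityCondition D) : StabilityCondition D where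
  Z := σ.Z.comp Φ.symm.mapNum
  P φ X := σ.P φ (Φ.equiv.inverse.obj X)
  iso_closed e := σ.iso_closed (Φ.equiv.inverse.mapIso e)
  zero_mem φ X hX := σ.zero_mem φ _ (Φ.equiv.inverse.map_isZero hX)
  biprod_mem hX hY := by
    have := preservesBinaryBiproducts_of_preservesBiproducts Φ.equiv.inverse
    exact σ.iso_closed (Φ.equiv.inverse.mapBiprod _ _).symm (σ.biprod_mem hX hY)
  phase {φ X} hX h0 := by
    rw [AddMonoidHom.comp_apply, ExactAuto.mapNum_of]
    exact σ.phase hX fun h => h0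
      ((Φ.equiv.functor.map_isZero h).of_iso (Φ.equiv.counitIso.app X).symm)
  shift_mem φ X := by
    rw [← σ.shift_mem φ]
    exact ⟨σ.iso_closed ((Φ.equiv.inverse.commShiftIso (1 : ℤ)).app X),
      σ.iso_closed ((Φ.equiv.inverse.commShiftIso (1 : ℤ)).app X).symm⟩
  hom_zero h h₁ h₂ f := Φ.equiv.inverse.map_injective <| by
    rw [σ.hom_zero h h₁ h₂ (Φ.equiv.inverse.map f), Functor.map_zero]
  hn X hX := by
    obtain ⟨H⟩ := σ.hn (Φ.equiv.inverse.obj X) fun h => hX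
      ((Φ.equiv.functor.map_isZero h).of_iso (Φ.equiv.counitIso.app X).symm)
    exact ⟨{ k := H.k
             E := fun i => Φ.equiv.functor.obj (H.E i)
             A := fun i => Φ.equiv.functor.obj (H.A i)
             φ := H.φ
             zero := Φ.equiv.functor.map_isZero H.zero
             top := H.top.map fun e => Φ.equiv.functor.mapIso e ≪≫ Φ.equiv.counitIso.app X
             triangle := fun i => by
               obtain ⟨f, g, h, hT⟩ := H.triangle i
               exact ⟨_, _, _, Φ.equiv.functor.map_distinguished _ hT⟩
             semistable := fun i =>
               σ.iso_closed (Φ.equiv.unitIso.app (H.A i)) (H.semistable i)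
             anti := H.anti }⟩
  support := by
    obtain ⟨C, hC, q, hq, h⟩ := σ.support
    let L : ℝ ⊗[ℤ] Num D →ₗ[ℝ] ℝ ⊗[ℤ] Num D :=
      Φ.symm.mapNum.toIntLinearMap.baseChange ℝ
    let L' : ℝ ⊗[ℤ] Num D →ₗ[ℝ] ℝ ⊗[ℤ] Num D :=
      Φ.mapNum.toIntLinearMap.baseChange ℝ
    have hL : ∀ x, L' (L x) = x := fun x => by
      induction x with
      | zero => simp
      | tmul r x =>
        show r ⊗ₜ (Φ.mapNum (Φ.symm.mapNum x)) = _
        rw [Φ.mapNum_symm]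
      | add x y hx hy => rw [map_add, map_add, hx, hy]
    refine ⟨C, hC, q.comp L, fun x hx => ?_, fun φ X hX => ?_⟩
    · rw [← hL x, hq (L x) hx, map_zero]
    · have := h φ _ hX
      rw [AddMonoidHom.comp_apply, ExactAuto.mapNum_of]
      show q (1 ⊗ₜ Φ.symm.mapNum (Num.of X)) ≤ _
      rw [ExactAuto.mapNum_of]
      exact this

theorem act_refl (σ : StabilityCondition D) : act ExactAuto.refl σ = σ := by
  refine StabilityCondition.ext ?_ rfl
  refine Num.hom_ext fun E => ?_
  show σ.Z (ExactAuto.refl.symm.mapNum (Num.of E)) = _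
  rw [ExactAuto.mapNum_of]
  rfl

theorem act_trans (Φ Ψ : ExactAuto D) (σ : StabilityCondition D) :
    act (Φ.trans Ψ) σ = act Ψ (act Φ σ) := by
  refine StabilityCondition.ext ?_ rfl
  refine Num.hom_ext fun E => ?_
  show σ.Z ((Φ.trans Ψ).symm.mapNum (Num.of E)) = σ.Z (Φ.symm.mapNum (Ψ.symm.mapNum (Num.of E)))
  rw [ExactAuto.mapNum_of, ExactAuto.mapNum_of, ExactAuto.mapNum_of]
  rfl

theorem act_symm (Φ : ExactAuto D) (σ : StabilityCondition D) : act Φ.symm (act Φ σ) = σ := by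
  refine StabilityCondition.ext ?_ ?_
  · refine Num.hom_ext fun E => ?_
    show σ.Z (Φ.symm.mapNum (Φ.symm.symm.mapNum (Num.of E))) = _
    rw [ExactAuto.mapNum_of, ExactAuto.mapNum_of]
    exact congrArg σ.Z (Num.of_iso (Φ.equiv.unitIso.app E).symm)
  · funext φ X
    exact propext ⟨σ.iso_closed (Φ.equiv.unitIso.app X).symm, σ.iso_closed (Φ.equiv.unitIso.app X)⟩

theorem act_vadd (Φ : ExactAuto D) (c : ℂ) (σ : StabilityCondition D) :
    act Φ (c +ᵥ σ) = c +ᵥ act Φ σ := rfl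

end StabilityCondition

section WeilPetersson

variable {ι : Type*} [Fintype ι] [DecidableEq ι] (β : Module.Basis ι ℤ (Num D)) (n : ℕ)

/-- The Gram matrix `χ(Eᵢ, Eⱼ)` of the Euler form in a basis of `N(D)`. -/
def eulerMatrix : Matrix ι ι ℂ := Matrix.of fun i j => (numEuler (β i) (β j) : ℂ)

/-- The bilinear form `𝔟(Z₁, Z₂) = ∑ χ^{i,j} Z₁(Eᵢ) Z₂(Eⱼ)` on `Hom(N(D), ℂ)`, where `(χ^{i,j})`
is the inverse of the Gram matrix. -/
def bForm (Z₁ Z₂ : Num D →+ ℂ) : ℂ :=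
  ∑ i, ∑ j, (eulerMatrix β)⁻¹ i j * Z₁ (β i) * Z₂ (β j)

/-- The complex conjugate of a central charge. -/
def conjCharge (Z : Num D →+ ℂ) : Num D →+ ℂ := (starRingEnd ℂ).toAddMonoidHom.comp Z

/-- The number `(√-1)⁻ⁿ 𝔟(Z, Z̄)`. -/
def hermNorm (Z : Num D →+ ℂ) : ℂ := (Complex.I ^ n)⁻¹ * bForm β Z (conjCharge Z)

theorem bForm_rotate (c : ℂ) (σ : StabilityCondition D) :
    bForm β (c +ᵥ σ).Z (c +ᵥ σ).Z = Complex.exp c * Complex.exp c * bForm β σ.Z σ.Z := by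
  simp only [bForm, Finset.mul_sum]
  refine Finset.sum_congr rfl fun i _ => Finset.sum_congr rfl fun j _ => ?_
  show _ * (Complex.exp c * σ.Z (β i)) * (Complex.exp c * σ.Z (β j)) = _
  ring

theorem hermNorm_rotate (c : ℂ) (σ : StabilityCondition D) :
    hermNorm β n (c +ᵥ σ).Z = (Complex.normSq (Complex.exp c) : ℂ) * hermNorm β n σ.Z := by
  simp only [hermNorm, bForm, Finset.mul_sum]
  refine Finset.sum_congr rfl fun i _ => Finset.sum_congr rfl fun j _ => ?_
  show _ * (_ * (Complex.exp c * σ.Z (β i)) * starRingEnd ℂ (Complex.exp c * σ.Z (β j))) = _ *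
    (_ * (_ * _ * starRingEnd ℂ (σ.Z (β j))))
  rw [map_mul, ← Complex.mul_conj]
  ring

theorem bForm_isometry (g h : Num D →+ Num D) (hgh : ∀ x, g (h x) = x)
    (hg : ∀ x y, numEuler (g x) (g y) = numEuler x y) (Z₁ Z₂ : Num D →+ ℂ) :
    bForm β (Z₁.comp g) (Z₂.comp g) = bForm β Z₁ Z₂ := by
  have key (Z₁ Z₂ : Num D →+ ℂ) : bForm β Z₁ Z₂ =
      (fun i => Z₁ (β i)) ⬝ᵥ ((eulerMatrix β)⁻¹.mulVec fun j => Z₂ (β j)) := by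
    simp only [bForm, dotProduct, Matrix.mulVec, Finset.mul_sum]
    refine Finset.sum_congr rfl fun i _ => Finset.sum_congr rfl fun j _ => by ring
  let G₀ := LinearMap.toMatrix β β g.toIntLinearMap
  let H₀ := LinearMap.toMatrix β β h.toIntLinearMap
  have hGH₀ : G₀ * H₀ = 1 := by
    rw [← LinearMap.toMatrix_comp, ← LinearMap.toMatrix_id β]
    congr 1
    ext x
    exact hgh x
  let G : Matrix ι ι ℂ := G₀.map (Int.castRingHom ℂ)
  have hGH : G * H₀.map (Int.castRingHom ℂ) = 1 := by
    rw [← Matrix.map_mul, hGH₀]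
    simp
  have hdet : IsUnit G.det := Matrix.isUnit_det_of_right_inverse hGH
  have exp (i : ι) : g (β i) = ∑ k, G₀ k i • β k := by
    conv_lhs => rw [← β.sum_repr (g (β i))]
    simp [G₀, LinearMap.toMatrix_apply]
  have hZ (Z : Num D →+ ℂ) : (fun i => (Z.comp g) (β i)) = G.transpose.mulVec fun k => Z (β k) := by
    funext i
    simp only [AddMonoidHom.comp_apply, exp, map_sum, map_zsmul, Matrix.mulVec, dotProduct,
      zsmul_eq_mul]
    rfl
  have hM : eulerMatrix β = G.transpose * eulerMatrix β * G := by
    ext i j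
    simp only [eulerMatrix, Matrix.of_apply]
    rw [← hg (β i) (β j), exp, exp]
    simp only [map_sum, map_zsmul, AddMonoidHom.finsetSum_apply, AddMonoidHom.coe_smul,
      Pi.smul_apply, Matrix.mul_apply, Matrix.transpose_apply, Matrix.of_apply, Finset.sum_mul,
      smul_eq_mul, Int.cast_sum, Int.cast_mul]
    refine Finset.sum_congr rfl fun k _ => ?_
    rw [Finset.mul_sum]
    refine Finset.sum_congr rfl fun l _ => ?_
    show _ = (G₀ l i : ℂ) * _ * (G₀ k j : ℂ)
    ring
  have hinv : G * (eulerMatrix β)⁻¹ * G.transpose = (eulerMatrix β)⁻¹ := by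
    conv_lhs => rw [hM, Matrix.mul_inv_rev, Matrix.mul_inv_rev]
    rw [Matrix.mul_nonsing_inv_cancel_left _ _ hdet, Matrix.mul_assoc,
      Matrix.nonsing_inv_mul _ (by rwa [Matrix.det_transpose]), Matrix.mul_one]
  rw [key, key, hZ, hZ, Matrix.mulVec_transpose, ← Matrix.dotProduct_mulVec, Matrix.mulVec_mulVec,
    Matrix.mulVec_mulVec, hinv]

theorem bForm_act (Φ : ExactAuto D) (σ : StabilityCondition D) :
    bForm β (σ.act Φ).Z (σ.act Φ).Z = bForm β σ.Z σ.Z :=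
  bForm_isometry β _ Φ.mapNum (Φ.symm.mapNum_symm) Φ.symm.numEuler_mapNum _ _

theorem hermNorm_act (Φ : ExactAuto D) (σ : StabilityCondition D) :
    hermNorm β n (σ.act Φ).Z = hermNorm β n σ.Z :=
  congrArg (fun z => (Complex.I ^ n)⁻¹ * z) (bForm_isometry β _ Φ.mapNum (Φ.symm.mapNum_symm) Φ.symm.numEuler_mapNum σ.Z
    (conjCharge σ.Z))

/-- The set `Stab⁺_N(D)` of stability conditions with `𝔟(Z, Z) = 0` and `(√-1)⁻ⁿ 𝔟(Z, Z̄) > 0`. -/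
def StabPlus : Type _ :=
  {σ : StabilityCondition D //
    bForm β σ.Z σ.Z = 0 ∧ 0 < (hermNorm β n σ.Z).re ∧ (hermNorm β n σ.Z).im = 0}

instance : TopologicalSpace (StabPlus β n) := inferInstanceAs (TopologicalSpace (Subtype _))

instance : AddAction ℂ (StabPlus β n) where
  vadd c σ := ⟨c +ᵥ σ.1, by
    have hpos : 0 < Complex.normSq (Complex.exp c) :=
      Complex.normSq_pos.2 (Complex.exp_ne_zero c)
    rw [bForm_rotate, hermNorm_rotate, σ.2.1, Complex.re_ofReal_mul, Complex.im_ofReal_mul,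
      σ.2.2.2]
    exact ⟨mul_zero _, mul_pos hpos σ.2.2.1, mul_zero _⟩⟩
  zero_vadd σ := Subtype.ext (zero_vadd ℂ σ.1)
  add_vadd c d σ := Subtype.ext (add_vadd c d σ.1)

variable {β n} in
/-- The action of autoequivalences on `Stab⁺_N(D)`. -/
def StabPlus.act (Φ : ExactAuto D) (σ : StabPlus β n) : StabPlus β n :=
  ⟨σ.1.act Φ, by rw [bForm_act, hermNorm_act]; exact σ.2⟩

variable {β} {n} in
/-- The values of the central charge on the basis: linear coordinates on `Hom(N(D), ℂ)`. -/
def StabPlus.charge (σ : StabPlus β n) : ι → ℂ := fun i => σ.1.Z (β i)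

/-- The quotient `Stab⁺_N(D)/ℂ`. -/
def ProjStab : Type _ := Quotient (AddAction.orbitRel ℂ (StabPlus β n))

instance : TopologicalSpace (ProjStab β n) := inferInstanceAs (TopologicalSpace (Quotient _))

variable {β n}

/-- The projection `Stab⁺_N(D) → Stab⁺_N(D)/ℂ`. -/
def ProjStab.mk (σ : StabPlus β n) : ProjStab β n := Quotient.mk _ σ

/-- The action of autoequivalences on `Stab⁺_N(D)/ℂ`. -/
def ProjStab.act (Φ : ExactAuto D) : ProjStab β n → ProjStab β n :=
  Quotient.map (StabPlus.act Φ) <| by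
    rintro _ σ ⟨c, rfl⟩
    exact ⟨c, rfl⟩

variable (β n) in
/-- Two points of `Stab⁺_N(D)/ℂ` are equivalent if an autoequivalence maps one to the other. -/
def autSetoid : Setoid (ProjStab β n) where
  r x y := ∃ Φ : ExactAuto D, ProjStab.act Φ x = y
  iseqv :=
    { refl := fun x => ⟨ExactAuto.refl, Quotient.inductionOn x fun σ =>
        congrArg ProjStab.mk (Subtype.ext (StabilityCondition.act_refl σ.1))⟩
      symm := by
        rintro x _ ⟨Φ, rfl⟩
        exact ⟨Φ.symm, Quotient.inductionOn x fun σ =>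
          congrArg ProjStab.mk (Subtype.ext (StabilityCondition.act_symm Φ σ.1))⟩
      trans := by
        rintro x _ _ ⟨Φ, rfl⟩ ⟨Ψ, rfl⟩
        exact ⟨Φ.trans Ψ, Quotient.inductionOn x fun σ =>
          congrArg ProjStab.mk (Subtype.ext (StabilityCondition.act_trans Φ Ψ σ.1))⟩ }

variable (β n) in
/-- The double quotient `Aut(D)\Stab⁺_N(D)/ℂ`. -/
def DoubleQuot : Type _ := Quotient (autSetoid β n)

instance : TopologicalSpace (DoubleQuot β n) := inferInstanceAs (TopologicalSpace (Quotient _))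

/-- The projection `Stab⁺_N(D)/ℂ → Aut(D)\Stab⁺_N(D)/ℂ`. -/
def DoubleQuot.mk (x : ProjStab β n) : DoubleQuot β n := Quotient.mk _ x

variable (β n) in
/-- The holomorphic charts of `Stab⁺_N(D)/ℂ`: homeomorphisms from open sets of the quotient to open
sets of `ℂᵐ` whose inverse lifts locally to continuous maps `f` to `Stab⁺_N(D)` with holomorphic
central charge, which are immersive modulo the tangent direction `ℂ · Z` of the `ℂ`-orbits. As the
central charge is a local coordinate of `Stab_N(D)`, these are exactly the charts of the complex
manifold structure of `Stab⁺_N(D)/ℂ`. -/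
def projCharts : ChartFamily (ProjStab β n) := fun m =>
  {c | ∀ w ∈ c.target, ∃ V : Set (Fin m → ℂ), IsOpen V ∧ w ∈ V ∧ V ⊆ c.target ∧
    ∃ f : (Fin m → ℂ) → StabPlus β n, ContinuousOn f V ∧
      (∀ v ∈ V, ProjStab.mk (f v) = c.symm v) ∧
      DifferentiableOn ℂ (fun v => (f v).charge) V ∧
      ∀ v ∈ V, ∀ t : Fin m → ℂ,
        (∃ r : ℂ, fderiv ℂ (fun u => (f u).charge) v t = r • (f v).charge) → t = 0}

/-- A local holomorphic section `s` over the open set `U` of `Stab⁺_N(D) → Stab⁺_N(D)/ℂ`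
(the values of `s` outside `U` play no role). -/
structure IsLocalSection (U : Set (ProjStab β n)) (s : ProjStab β n → StabPlus β n) : Prop where
  isOpen : IsOpen U
  continuousOn : ContinuousOn s U
  mk_eq : ∀ x ∈ U, ProjStab.mk (s x) = x
  holomorphic : ∀ m, ∀ c ∈ projCharts β n m,
    DifferentiableOn ℂ (fun v => (s (c.symm v)).charge) (c.target ∩ c.symm ⁻¹' U)

/-- The Weil--Petersson potential `-log ((√-1)⁻ⁿ 𝔟(Z, Z̄))` of a section. -/
def potential (s : ProjStab β n → StabPlus β n) (x : ProjStab β n) : ℝ :=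
  -Real.log (hermNorm β n (s x).1.Z).re

/-- The form `η` is equal to `(√-1/2) ∂∂̄K` on `U`. -/
def OneOneForm.IsHessianOn (η : OneOneForm (projCharts β n)) (U : Set (ProjStab β n))
    (K : ProjStab β n → ℝ) : Prop :=
  ∀ m c (hc : c ∈ projCharts β n m), ∀ w ∈ c.target, c.symm w ∈ U →
    η.coeff m c hc w = complexHessian (fun v => K (c.symm v)) w

variable (β n) in
/-- The complement of the singular locus of the double quotient: the largest open set over which
`Stab⁺_N(D)/ℂ → Aut(D)\Stab⁺_N(D)/ℂ` is a local homeomorphism, that is, the image of the set of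
points near which the (continuous and open) projection is injective. -/
def regularLocus : Set (DoubleQuot β n) :=
  DoubleQuot.mk '' {x | ∃ V ∈ 𝓝 x, Set.InjOn DoubleQuot.mk V}

variable (β n) in
/-- The holomorphic charts of the regular locus of the double quotient: those for which the
projection from `Stab⁺_N(D)/ℂ` is locally biholomorphic. -/
def doubleCharts : ChartFamily (DoubleQuot β n) := fun m =>
  {c | c.source ⊆ regularLocus β n ∧ ∀ w ∈ c.target, ∃ c' ∈ projCharts β n m,
    w ∈ c'.target ∧ c'.target ⊆ c.target ∧
      ∀ v ∈ c'.target, c.symm v = DoubleQuot.mk (c'.symm v)}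

end WeilPetersson

end Category
end

end StabWP

/-!
Every potential in question is `-log Q(Z)`, where `Q(Z) = Re ((√-1)⁻ⁿ 𝔟(Z, Z̄))` scales by
`Q(r Z) = |r|² Q(Z)`. Two holomorphic lifts of the same open set of `Stab⁺_N(D)/ℂ` differ by the
action of `ℂ`, hence their central charges differ by a holomorphic factor `l` without zeros, and the
potentials differ by `-log |l|²`, which is pluriharmonic (`complexHessian_log_normSq`). Together with
the chain rule for complex Hessians under holomorphic maps (`complexHessian_comp`) this proves that
the Hessians are compatible (`complexHessian_of_proportional`).

The remaining analytic point is that the maps between charts are holomorphic, although only their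
continuity is evident. A chart has a lift whose central charge is immersive modulo `ℂ · Z`; divided
by a nonzero coordinate it is an immersion into an affine chart of projective space, and a local
holomorphic left inverse expresses the map in question through a holomorphic one
(`differentiableAt_of_proportional`). In this way holomorphy of the changes of charts and of the
autoequivalences, independence of the lift, and invariance of the form are all instances of one
statement, `IsLift.pullback`; the invariance uses that `Aut(D)` preserves the Euler form, and that it
acts continuously because it permutes Harder--Narasimhan filtrations.

For the double quotient, the projection is injective near each point over the regular locus, so a
continuous map between charts which covers the identity there is locally given by a single
autoequivalence (`OneOneForm.pullback_of_mk_eq`). Hence the coefficients of the invariant form in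
local lifts of the charts define the descended form.
-/

namespace StabWP

noncomputable section

set_option linter.unusedSectionVars false

/-! ### Holomorphic functions of several variables are smooth -/

section Holomorphic

variable {E : Type*} [NormedAddCommGroup E] [NormedSpace ℂ E] [FiniteDimensional ℂ E]
  {F : Type*} [NormedAddCommGroup F] [NormedSpace ℂ F] [FiniteDimensional ℂ F]

/-- A directional derivative of a holomorphic function of several variables is holomorphic: it is a
Cauchy integral over a circle in the given direction, and this can be differentiated under the
integral sign because holomorphic functions satisfy Cauchy estimates. -/
theorem differentiableOn_fderiv_apply {f : E → F} {U : Set E} (hU : IsOpen U)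
    (hf : DifferentiableOn ℂ f U) (y : E) : DifferentiableOn ℂ (fun v => fderiv ℂ f v y) U := by
  intro x₀ hx₀
  refine DifferentiableAt.differentiableWithinAt ?_
  have hfc := (hf.differentiableAt (hU.mem_nhds hx₀)).continuousAt
  obtain ⟨ε, hε, hεU⟩ : ∃ ε > 0, ∀ z ∈ Metric.ball x₀ ε, z ∈ U ∧ dist (f z) (f x₀) < 1 :=
    Metric.eventually_nhds_iff_ball.1 ((hU.eventually_mem hx₀).and
      (hfc.eventually (Metric.ball_mem_nhds _ one_pos)))
  -- small enough that circles of radius `r` in direction `y` around points of the ball of radius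
  -- `ε / 4` stay in the ball of radius `ε / 2`, where the Cauchy estimate bounds `fderiv ℂ f`
  set r : ℝ := ε / (4 * (‖y‖ + 1)) with hr
  have hy : 0 < ‖y‖ + 1 := by positivity
  have hrpos : 0 < r := by positivity
  have hry : r * ‖y‖ < ε / 4 := by
    rw [hr, div_mul_eq_mul_div, div_lt_div_iff₀ (by positivity) (by norm_num)]
    nlinarith
  have hmem : ∀ v ∈ Metric.ball x₀ (ε / 4), ∀ ζ : ℂ, ‖ζ‖ < 2 * r →
      v + ζ • y ∈ Metric.ball x₀ ε := by
    intro v hv ζ hζ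
    rw [mem_ball_iff_norm] at hv ⊢
    calc ‖v + ζ • y - x₀‖ = ‖(v - x₀) + ζ • y‖ := by congr 1; abel
      _ ≤ ‖v - x₀‖ + ‖ζ‖ * ‖y‖ := (norm_add_le _ _).trans_eq (by rw [norm_smul])
      _ ≤ ‖v - x₀‖ + 2 * r * ‖y‖ := by gcongr
      _ < ε := by linarith
  have hmem' : ∀ v ∈ Metric.ball x₀ (ε / 4), ∀ θ : ℝ,
      v + circleMap 0 r θ • y ∈ Metric.ball x₀ (ε / 2) := by
    intro v hv θ
    rw [mem_ball_iff_norm] at hv ⊢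
    calc ‖v + circleMap 0 r θ • y - x₀‖ = ‖(v - x₀) + circleMap 0 r θ • y‖ := by congr 1; abel
      _ ≤ ‖v - x₀‖ + ‖circleMap 0 r θ‖ * ‖y‖ := (norm_add_le _ _).trans_eq (by rw [norm_smul])
      _ = ‖v - x₀‖ + r * ‖y‖ := by rw [norm_circleMap_zero, abs_of_pos hrpos]
      _ < ε / 2 := by linarith
  have hdiff : ∀ z ∈ Metric.ball x₀ ε, DifferentiableAt ℂ f z := fun z hz =>
    hf.differentiableAt (hU.mem_nhds (hεU z hz).1)
  have hbound : ∀ z ∈ Metric.ball x₀ (ε / 2), ‖fderiv ℂ f z‖ ≤ 2 / (ε / 2) := by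
    intro z hz
    have hsub : Metric.ball z (ε / 2) ⊆ Metric.ball x₀ ε :=
      Metric.ball_subset_ball' (by rw [Metric.mem_ball] at hz; linarith)
    refine Complex.norm_fderiv_le_div_of_mapsTo_ball (f := f)
      (fun u hu => (hdiff u (hsub hu)).differentiableWithinAt) ?_ (by positivity)
    intro u hu
    have h1 := (hεU u (hsub hu)).2
    have h2 := (hεU z (hsub (Metric.mem_ball_self (by positivity)))).2
    rw [dist_comm] at h2
    exact (dist_triangle _ _ _).trans (by linarith)
  let k : ℝ → ℂ := fun θ => deriv (circleMap 0 r) θ * ((circleMap 0 r θ - 0) ^ 2)⁻¹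
  have hk : Continuous k := by
    refine Continuous.mul ?_ (Continuous.inv₀ (by fun_prop) fun θ => ?_)
    · rw [funext (deriv_circleMap 0 r)]; fun_prop
    · exact pow_ne_zero 2 (sub_ne_zero.2 (circleMap_ne_center hrpos.ne'))
  have hcauchy : ∀ v ∈ Metric.ball x₀ (ε / 4), fderiv ℂ f v y =
      (2 * Real.pi * Complex.I : ℂ)⁻¹ •
        ∫ θ in Set.Ioc 0 (2 * Real.pi), k θ • f (v + circleMap 0 r θ • y) := by
    intro v hv
    have hv' : v ∈ Metric.ball x₀ ε := Metric.ball_subset_ball (by linarith) hv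
    have hd : DifferentiableOn ℂ (fun ζ : ℂ => f (v + ζ • y)) (Metric.ball 0 (2 * r)) := by
      intro ζ hζ
      refine DifferentiableAt.differentiableWithinAt ?_
      exact (hdiff _ (hmem v hv ζ (by simpa using hζ))).comp ζ (by fun_prop)
    have h := Complex.two_pi_I_inv_smul_circleIntegral_sub_sq_inv_smul_of_differentiable
      Metric.isOpen_ball (Metric.closedBall_subset_ball (by linarith)) hd
      (Metric.mem_ball_self hrpos)
    have hder : HasDerivAt (fun ζ : ℂ => f (v + ζ • y)) (fderiv ℂ f v y) 0 := by
      have h1 : HasFDerivAt f (fderiv ℂ f v) (v + (0 : ℂ) • y) := by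
        simpa using (hdiff v hv').hasFDerivAt
      have h2 : HasDerivAt (fun ζ : ℂ => v + ζ • y) y 0 := by
        simpa using ((hasDerivAt_id (0 : ℂ)).smul_const y).const_add v
      exact h1.comp_hasDerivAt 0 h2
    rw [hder.deriv] at h
    rw [← h, circleIntegral, intervalIntegral.integral_of_le (by positivity)]
    simp only [k, mul_smul]
  have hballs : Metric.ball x₀ (ε / 4) ∈ 𝓝 x₀ := Metric.ball_mem_nhds _ (by positivity)
  refine DifferentiableAt.congr_of_eventuallyEq ?_ (Filter.eventuallyEq_of_mem hballs hcauchy)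
  refine DifferentiableAt.const_smul ?_ _
  have hcont : ∀ v ∈ Metric.ball x₀ (ε / 4),
      Continuous fun θ : ℝ => k θ • f (v + circleMap 0 r θ • y) := by
    intro v hv
    refine hk.smul (continuous_iff_continuousAt.2 fun θ => ?_)
    have h1 : ContinuousAt f (v + circleMap 0 r θ • y) :=
      (hdiff _ (Metric.ball_subset_ball (by linarith) (hmem' v hv θ))).continuousAt
    exact ContinuousAt.comp (f := fun θ : ℝ => v + circleMap 0 r θ • y) h1
      (by fun_prop)
  have : SecondCountableTopology (E →L[ℂ] F) := by
    have : ProperSpace (E →L[ℂ] F) := FiniteDimensional.proper ℂ _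
    infer_instance
  have : CompleteSpace F := FiniteDimensional.complete ℂ F
  refine (hasFDerivAt_integral_of_dominated_of_fderiv_le
    (F' := fun v θ => k θ • fderiv ℂ f (v + circleMap 0 r θ • y))
    (bound := fun θ => ‖k θ‖ * (2 / (ε / 2))) hballs ?_ ?_ ?_ ?_ ?_ ?_).differentiableAt
  · exact Filter.eventually_of_mem hballs fun v hv => (hcont v hv).aestronglyMeasurable
  · exact ((hcont x₀ (Metric.mem_ball_self (by positivity))).integrableOn_Ioc)
  · borelize E (E →L[ℂ] F)
    refine hk.aestronglyMeasurable.smul (Measurable.aestronglyMeasurable ?_)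
    exact (measurable_fderiv ℂ f).comp (by fun_prop : Continuous _).measurable
  · refine Filter.Eventually.of_forall fun θ v hv => ?_
    rw [norm_smul]
    gcongr
    exact hbound _ (hmem' v hv θ)
  · exact (by fun_prop : Continuous fun θ => ‖k θ‖ * (2 / (ε / 2))).integrableOn_Ioc
  · refine Filter.Eventually.of_forall fun θ v hv => ?_
    refine HasFDerivAt.const_smul ?_ (k θ)
    have h1 := (hdiff _ (Metric.ball_subset_ball (by linarith) (hmem' v hv θ))).hasFDerivAt
    exact h1.comp v ((hasFDerivAt_id v).add_const _)

/-- A holomorphic function on an open set of a finite-dimensional complex vector space is smooth. -/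
theorem contDiffOn_of_differentiableOn {f : E → F} {U : Set E} (hU : IsOpen U)
    (hf : DifferentiableOn ℂ f U) : ContDiffOn ℂ ∞ f U := by
  refine contDiffOn_infty.2 fun n => ?_
  induction n generalizing f with
  | zero => exact contDiffOn_zero.2 hf.continuousOn
  | succ n ih =>
    have h := (contDiffOn_succ_iff_fderiv_of_isOpen (n := n) (f := f) (𝕜 := ℂ) hU).2
      ⟨hf, by simp, ?_⟩
    · exact_mod_cast h
    · exact contDiffOn_clm_apply.2 fun y => ih (differentiableOn_fderiv_apply hU hf y)

theorem contDiffAt_of_eventually_differentiableAt {f : E → F} {x : E}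
    (hf : ∀ᶠ v in 𝓝 x, DifferentiableAt ℂ f v) : ContDiffAt ℂ ∞ f x := by
  obtain ⟨U, hUx, hU, hx⟩ := eventually_nhds_iff.1 hf
  exact (contDiffOn_of_differentiableOn hU fun v hv =>
    (hUx v hv).differentiableWithinAt).contDiffAt (hU.mem_nhds hx)

end Holomorphic

/-! ### Wirtinger derivatives and complex Hessians -/

section Wirtinger

variable {m m' : ℕ}

/-- A real-linear functional on `ℂᵐ` is the sum of its complex-linear and antilinear parts. -/
theorem realLinear_apply_eq_sum (L : (Fin m → ℂ) →L[ℝ] ℂ) (s : Fin m → ℂ) :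
    L s = ∑ i, ((L (Pi.single i 1) - Complex.I * L (Pi.single i Complex.I)) / 2 * s i +
      (L (Pi.single i 1) + Complex.I * L (Pi.single i Complex.I)) / 2 * starRingEnd ℂ (s i)) := by
  have hs : s = ∑ i, ((s i).re • (Pi.single i 1 : Fin m → ℂ) +
      (s i).im • (Pi.single i Complex.I : Fin m → ℂ)) := by
    ext k
    simp [Finset.sum_apply, Pi.single_apply, Finset.sum_add_distrib]
  conv_lhs => rw [hs]
  rw [map_sum]
  refine Finset.sum_congr rfl fun i _ => ?_
  rw [map_add, map_smul, map_smul, Complex.real_smul, Complex.real_smul, Complex.re_eq_add_conj,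
    Complex.im_eq_sub_conj]
  field_simp
  ring_nf
  simp only [Complex.I_sq]
  ring

theorem fderiv_single_I {E : Type*} [NormedAddCommGroup E] [NormedSpace ℂ E]
    (L : (Fin m → ℂ) →L[ℂ] E) (j : Fin m) :
    L (Pi.single j Complex.I) = Complex.I • L (Pi.single j 1) := by
  rw [← map_smul, ← Pi.single_smul, smul_eq_mul, mul_one]

theorem fderiv_real_comp_holomorphic {F : (Fin m' → ℂ) → ℂ} {g : (Fin m → ℂ) → Fin m' → ℂ}
    {w : Fin m → ℂ} (hF : DifferentiableAt ℝ F (g w)) (hg : DifferentiableAt ℂ g w)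
    (t : Fin m → ℂ) :
    fderiv ℝ (fun v => F (g v)) w t = fderiv ℝ F (g w) (fderiv ℂ g w t) := by
  have h := hF.hasFDerivAt.comp w (hg.hasFDerivAt.restrictScalars ℝ)
  exact congrArg (fun L => L t) h.fderiv

theorem wirtinger_comp {F : (Fin m' → ℂ) → ℂ} {g : (Fin m → ℂ) → Fin m' → ℂ}
    {w : Fin m → ℂ} (hF : DifferentiableAt ℝ F (g w)) (hg : DifferentiableAt ℂ g w) (j : Fin m) :
    wirtinger j (fun v => F (g v)) w = ∑ i, wirtinger i F (g w) * jacobian g w i j := by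
  rw [wirtinger, fderiv_real_comp_holomorphic hF hg, fderiv_real_comp_holomorphic hF hg,
    fderiv_single_I, realLinear_apply_eq_sum, realLinear_apply_eq_sum (fderiv ℝ F (g w)) (_ • _),
    Finset.mul_sum, ← Finset.sum_sub_distrib, Finset.sum_div]
  refine Finset.sum_congr rfl fun i _ => ?_
  simp only [wirtinger, jacobian, Matrix.of_apply, Pi.smul_apply, smul_eq_mul, map_mul,
    Complex.conj_I]
  linear_combination (-(fderiv ℝ F (g w) (Pi.single i 1) - Complex.I *
    fderiv ℝ F (g w) (Pi.single i Complex.I)) / 4 * fderiv ℂ g w (Pi.single j 1) i +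
    (fderiv ℝ F (g w) (Pi.single i 1) + Complex.I *
    fderiv ℝ F (g w) (Pi.single i Complex.I)) / 4 *
      starRingEnd ℂ (fderiv ℂ g w (Pi.single j 1) i)) * Complex.I_sq

theorem wirtingerBar_comp {F : (Fin m' → ℂ) → ℂ} {g : (Fin m → ℂ) → Fin m' → ℂ}
    {w : Fin m → ℂ} (hF : DifferentiableAt ℝ F (g w)) (hg : DifferentiableAt ℂ g w) (j : Fin m) :
    wirtingerBar j (fun v => F (g v)) w =
      ∑ i, wirtingerBar i F (g w) * starRingEnd ℂ (jacobian g w i j) := by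
  rw [wirtingerBar, fderiv_real_comp_holomorphic hF hg, fderiv_real_comp_holomorphic hF hg,
    fderiv_single_I, realLinear_apply_eq_sum, realLinear_apply_eq_sum (fderiv ℝ F (g w)) (_ • _),
    Finset.mul_sum, ← Finset.sum_add_distrib, Finset.sum_div]
  refine Finset.sum_congr rfl fun i _ => ?_
  simp only [wirtingerBar, jacobian, Matrix.of_apply, Pi.smul_apply, smul_eq_mul, map_mul,
    Complex.conj_I]
  linear_combination ((fderiv ℝ F (g w) (Pi.single i 1) - Complex.I *
    fderiv ℝ F (g w) (Pi.single i Complex.I)) / 4 * fderiv ℂ g w (Pi.single j 1) i -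
    (fderiv ℝ F (g w) (Pi.single i 1) + Complex.I *
    fderiv ℝ F (g w) (Pi.single i Complex.I)) / 4 *
      starRingEnd ℂ (fderiv ℂ g w (Pi.single j 1) i)) * Complex.I_sq

theorem wirtinger_congr {f f' : (Fin m → ℂ) → ℂ} {w : Fin m → ℂ} (h : f =ᶠ[𝓝 w] f') (j : Fin m) :
    wirtinger j f w = wirtinger j f' w := by
  rw [wirtinger, wirtinger, h.fderiv_eq]

theorem wirtingerBar_congr {f f' : (Fin m → ℂ) → ℂ} {w : Fin m → ℂ} (h : f =ᶠ[𝓝 w] f')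
    (j : Fin m) : wirtingerBar j f w = wirtingerBar j f' w := by
  rw [wirtingerBar, wirtingerBar, h.fderiv_eq]

theorem complexHessian_congr {K K' : (Fin m → ℂ) → ℝ} {w : Fin m → ℂ} (h : K =ᶠ[𝓝 w] K') :
    complexHessian K w = complexHessian K' w := by
  ext j k
  refine wirtinger_congr ?_ j
  filter_upwards [h.eventuallyEq_nhds] with v hv
  exact wirtingerBar_congr (hv.fun_comp fun x : ℝ => (x : ℂ)) k

theorem wirtinger_mul {f f' : (Fin m → ℂ) → ℂ} {w : Fin m → ℂ} (hf : DifferentiableAt ℝ f w)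
    (hf' : DifferentiableAt ℝ f' w) (j : Fin m) :
    wirtinger j (fun v => f v * f' v) w = wirtinger j f w * f' w + f w * wirtinger j f' w := by
  simp only [wirtinger, fderiv_fun_mul hf hf', add_apply,
    smul_apply, smul_eq_mul]
  ring

theorem wirtinger_sum {ι : Type*} (s : Finset ι) {f : ι → (Fin m → ℂ) → ℂ} {w : Fin m → ℂ}
    (hf : ∀ i ∈ s, DifferentiableAt ℝ (f i) w) (j : Fin m) :
    wirtinger j (fun v => ∑ i ∈ s, f i v) w = ∑ i ∈ s, wirtinger j (f i) w := by
  simp only [wirtinger, fderiv_fun_sum hf, sum_apply, Finset.mul_sum,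
    ← Finset.sum_sub_distrib, Finset.sum_div]

theorem wirtinger_conj_holomorphic {h : (Fin m → ℂ) → ℂ} {w : Fin m → ℂ}
    (hh : DifferentiableAt ℂ h w) (j : Fin m) :
    wirtinger j (fun v => starRingEnd ℂ (h v)) w = 0 := by
  have h1 : HasFDerivAt (fun v => starRingEnd ℂ (h v)) _ w :=
    (Complex.conjCLE.toContinuousLinearMap.hasFDerivAt (x := h w)).comp w
      (hh.hasFDerivAt.restrictScalars ℝ)
  rw [wirtinger, h1.fderiv]
  simp [fderiv_single_I, ← mul_assoc]

theorem contDiffAt_wirtingerBar {F : (Fin m → ℂ) → ℂ} {w : Fin m → ℂ} (hF : ContDiffAt ℝ ∞ F w)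
    (k : Fin m) : ContDiffAt ℝ ∞ (wirtingerBar k F) w := by
  have h : ContDiffAt ℝ ∞ (fderiv ℝ F) w := hF.fderiv_right (by simp)
  unfold wirtingerBar
  fun_prop

theorem contDiffAt_wirtinger {F : (Fin m → ℂ) → ℂ} {w : Fin m → ℂ} (hF : ContDiffAt ℝ ∞ F w)
    (k : Fin m) : ContDiffAt ℝ ∞ (wirtinger k F) w := by
  have h : ContDiffAt ℝ ∞ (fderiv ℝ F) w := hF.fderiv_right (by simp)
  unfold wirtinger
  fun_prop

theorem contDiffAt_ofReal {K : (Fin m → ℂ) → ℝ} {w : Fin m → ℂ} (hK : ContDiffAt ℝ ∞ K w) :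
    ContDiffAt ℝ ∞ (fun v => (K v : ℂ)) w :=
  Complex.ofRealCLM.contDiff.contDiffAt.comp w hK

theorem contDiffAt_complexHessian {K : (Fin m → ℂ) → ℝ} {w : Fin m → ℂ} (hK : ContDiffAt ℝ ∞ K w)
    (j k : Fin m) : ContDiffAt ℝ ∞ (fun v => complexHessian K v j k) w :=
  contDiffAt_wirtinger (contDiffAt_wirtingerBar (contDiffAt_ofReal hK) k) j

theorem complexHessian_add {K K' : (Fin m → ℂ) → ℝ} {w : Fin m → ℂ} (hK : ContDiffAt ℝ ∞ K w)
    (hK' : ContDiffAt ℝ ∞ K' w) :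
    complexHessian (fun v => K v + K' v) w = complexHessian K w + complexHessian K' w := by
  ext j k
  have hC := contDiffAt_ofReal hK
  have hC' := contDiffAt_ofReal hK'
  have h : wirtingerBar k (fun v => ((K v + K' v : ℝ) : ℂ)) =ᶠ[𝓝 w]
      fun v => wirtingerBar k (fun v => (K v : ℂ)) v + wirtingerBar k (fun v => (K' v : ℂ)) v := by
    filter_upwards [(hC.of_le (m := 1) (by simp)).eventually (by simp),
      (hC'.of_le (m := 1) (by simp)).eventually (by simp)] with v hv hv'
    simp only [wirtingerBar, Complex.ofReal_add]
    rw [fderiv_fun_add (hv.differentiableAt (by simp)) (hv'.differentiableAt (by simp))]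
    simp only [add_apply]
    ring
  have e := wirtinger_congr h j
  have d := (contDiffAt_wirtingerBar hC k).differentiableAt (by simp)
  have d' := (contDiffAt_wirtingerBar hC' k).differentiableAt (by simp)
  show wirtinger j _ w = wirtinger j _ w + wirtinger j _ w
  rw [e, wirtinger, fderiv_fun_add d d']
  simp only [wirtinger, add_apply]
  ring

/-- Transformation of the complex Hessian under holomorphic maps: no derivative of the Jacobian
appears, because `∂` kills the antiholomorphic functions `conj (∂gᵢ/∂zₖ)`. -/
theorem complexHessian_comp {K : (Fin m' → ℂ) → ℝ} {g : (Fin m → ℂ) → Fin m' → ℂ}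
    {w : Fin m → ℂ} (hK : ContDiffAt ℝ ∞ K (g w)) (hg : ∀ᶠ v in 𝓝 w, DifferentiableAt ℂ g v) :
    complexHessian (fun v => K (g v)) w = (jacobian g w).transpose * complexHessian K (g w) *
      (jacobian g w).map (starRingEnd ℂ) := by
  ext j k
  have hC := contDiffAt_ofReal hK
  have hgw := hg.self_of_nhds
  have hbar (i : Fin m') := (contDiffAt_wirtingerBar hC i).differentiableAt (by simp)
  have hjac (i : Fin m') : DifferentiableAt ℂ (fun v => jacobian g v i k) w := by
    have h1 : ContDiffAt ℂ ∞ (fderiv ℂ g) w :=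
      (contDiffAt_of_eventually_differentiableAt hg).fderiv_right (by simp)
    have h2 : DifferentiableAt ℂ (fun v => fderiv ℂ g v (Pi.single k 1)) w :=
      (h1.differentiableAt (by simp)).clm_apply (differentiableAt_const _)
    exact differentiableAt_pi.1 h2 i
  have hconj (i : Fin m') : DifferentiableAt ℝ (fun v => starRingEnd ℂ (jacobian g v i k)) w :=
    Complex.conjCLE.differentiableAt.comp w ((hjac i).restrictScalars ℝ)
  have hcomp (i : Fin m') : DifferentiableAt ℝ
      (fun v => wirtingerBar i (fun u => (K u : ℂ)) (g v)) w :=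
    (hbar i).comp w (hgw.restrictScalars ℝ)
  have h : wirtingerBar k (fun v => (K (g v) : ℂ)) =ᶠ[𝓝 w] fun v =>
      ∑ i, wirtingerBar i (fun u => (K u : ℂ)) (g v) * starRingEnd ℂ (jacobian g v i k) := by
    filter_upwards [hg, hgw.continuousAt.eventually
      ((hC.of_le (m := 1) (by simp)).eventually (by simp))] with v hv hv'
    exact wirtingerBar_comp (hv'.differentiableAt (by simp)) hv k
  show wirtinger j _ w = _
  rw [wirtinger_congr h j, wirtinger_sum _ fun i _ => (hcomp i).fun_mul (hconj i), Matrix.mul_apply]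
  refine Finset.sum_congr rfl fun i _ => ?_
  rw [wirtinger_mul (hcomp i) (hconj i), wirtinger_conj_holomorphic (hjac i), mul_zero, add_zero,
    wirtinger_comp (hbar i) hgw, Matrix.mul_apply]
  refine congrArg (· * _) (Finset.sum_congr rfl fun l _ => ?_)
  rw [Matrix.transpose_apply, mul_comm]
  rfl

theorem complexHessian_re_holomorphic {l : (Fin m → ℂ) → ℂ} {w : Fin m → ℂ}
    (hl : ∀ᶠ v in 𝓝 w, DifferentiableAt ℂ l v) : complexHessian (fun v => (l v).re) w = 0 := by
  ext j k
  have h : wirtingerBar k (fun v => ((l v).re : ℂ)) =ᶠ[𝓝 w]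
      fun v => starRingEnd ℂ (fderiv ℂ l v (Pi.single k 1) / 2) := by
    filter_upwards [hl] with v hv
    have h1 : HasFDerivAt (fun v => ((l v).re : ℂ)) _ v :=
      ((Complex.ofRealCLM.comp Complex.reCLM).hasFDerivAt (x := l v)).comp v
        (hv.hasFDerivAt.restrictScalars ℝ)
    rw [wirtingerBar, h1.fderiv]
    simp only [ContinuousLinearMap.comp_apply, ContinuousLinearMap.coe_restrictScalars',
      fderiv_single_I, Complex.reCLM_apply, Complex.ofRealCLM_apply]
    rw [map_div₀, map_ofNat]
    apply Complex.ext <;> simp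
  have h1 : ContDiffAt ℂ ∞ (fderiv ℂ l) w :=
    (contDiffAt_of_eventually_differentiableAt hl).fderiv_right (by simp)
  have h2 : DifferentiableAt ℂ (fun v => fderiv ℂ l v (Pi.single k 1) / 2) w :=
    by
    simp only [div_eq_mul_inv]
    exact ((h1.differentiableAt (by simp)).clm_apply (differentiableAt_const _)).mul_const _
  exact (wirtinger_congr h j).trans (wirtinger_conj_holomorphic h2 j)

/-- `log |l|²` is pluriharmonic for `l` holomorphic without zeros: up to a constant, it is the real
part of a branch of `2 log l`. -/
theorem complexHessian_log_normSq {l : (Fin m → ℂ) → ℂ} {w : Fin m → ℂ}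
    (hl : ∀ᶠ v in 𝓝 w, DifferentiableAt ℂ l v) (h0 : l w ≠ 0) :
    complexHessian (fun v => Real.log (Complex.normSq (l v))) w = 0 := by
  have hcont : ContinuousAt (fun v => l v / l w) w :=
    hl.self_of_nhds.continuousAt.div_const _
  have hslit : ∀ᶠ v in 𝓝 w, l v / l w ∈ Complex.slitPlane :=
    hcont.eventually (Complex.isOpen_slitPlane.mem_nhds (by simp [div_self h0]))
  have e : (fun v => Real.log (Complex.normSq (l v))) =ᶠ[𝓝 w]
      fun v => (2 * Complex.log (l v / l w) + (Real.log (Complex.normSq (l w)) : ℂ)).re := by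
    filter_upwards [hl.self_of_nhds.continuousAt.eventually_ne h0] with v hv
    rw [Complex.add_re, Complex.ofReal_re, Complex.mul_re, Complex.re_ofNat, Complex.im_ofNat,
      Complex.log_re, norm_div,
      Real.log_div (norm_ne_zero_iff.2 hv) (norm_ne_zero_iff.2 h0), Complex.normSq_eq_norm_sq,
      Complex.normSq_eq_norm_sq, Real.log_pow, Real.log_pow]
    push_cast
    ring
  rw [complexHessian_congr e]
  refine complexHessian_re_holomorphic ?_
  filter_upwards [hl, hslit] with v hv hv'
  have h : DifferentiableAt ℂ (fun v => l v / l w) v := by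
    simpa only [div_eq_mul_inv] using hv.mul_const _
  exact ((h.clog hv').const_mul 2).add_const _

end Wirtinger

/-! ### Maps that agree up to scalar factors -/

section ConeMaps

variable {m m' : ℕ} {ι : Type*} [Fintype ι]

/-- If a map `B` to a vector space is immersive modulo its own direction, then `B` up to scalars
determines the parameter holomorphically: `g` is holomorphic as soon as it is continuous and
`B ∘ g` is holomorphic up to scalar factors. Dividing by a nonzero coordinate makes `B` a genuine
immersion, which has a holomorphic left inverse by the inverse function theorem. -/
theorem differentiableAt_of_proportional {A : (Fin m → ℂ) → ι → ℂ} {B : (Fin m' → ℂ) → ι → ℂ}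
    {g : (Fin m → ℂ) → Fin m' → ℂ} {w : Fin m → ℂ} (hA : DifferentiableAt ℂ A w)
    (hB : ∀ᶠ u in 𝓝 (g w), DifferentiableAt ℂ B u) (hg : ContinuousAt g w) (hB0 : B (g w) ≠ 0)
    (himm : ∀ t, (∃ r : ℂ, fderiv ℂ B (g w) t = r • B (g w)) → t = 0)
    (hAB : ∀ᶠ v in 𝓝 w, ∃ r : ℂ, r ≠ 0 ∧ A v = r • B (g v)) : DifferentiableAt ℂ g w := by
  obtain ⟨i, hi⟩ := Function.ne_iff.1 hB0
  have hi : B (g w) i ≠ 0 := hi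
  have hBd := hB.self_of_nhds
  have hBi : DifferentiableAt ℂ (fun u => B u i) (g w) := differentiableAt_pi.1 hBd i
  let k : (Fin m' → ℂ) → ι → ℂ := fun u => (B u i)⁻¹ • B u
  have hk : HasStrictFDerivAt k (fderiv ℂ k (g w)) (g w) := by
    refine ContDiffAt.hasStrictFDerivAt (n := ∞) ?_ (by simp)
    refine contDiffAt_of_eventually_differentiableAt ?_
    filter_upwards [hB, hBi.continuousAt.eventually_ne hi] with u hu hu'
    exact ((differentiableAt_pi.1 hu i).fun_inv hu').smul hu
  have hker : LinearMap.ker (fderiv ℂ k (g w)).toLinearMap = ⊥ := by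
    refine LinearMap.ker_eq_bot'.2 fun t ht => himm t ?_
    have ht : fderiv ℂ k (g w) t = 0 := ht
    -- the derivative of `B = Bᵢ • k` in a direction killed by `k'` is a multiple of `k`
    have hprod : HasFDerivAt (fun u => B u i • k u) _ (g w) :=
      hBi.hasFDerivAt.smul hk.hasFDerivAt
    have heq : (fun u => B u i • k u) =ᶠ[𝓝 (g w)] B := by
      filter_upwards [hBi.continuousAt.eventually_ne hi] with u hu
      exact smul_inv_smul₀ hu (B u)
    rw [← heq.fderiv_eq, hprod.fderiv]
    refine ⟨fderiv ℂ (fun u => B u i) (g w) t * (B (g w) i)⁻¹, ?_⟩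
    simp [ht, k, mul_smul]
  obtain ⟨L₀, hL₀⟩ := LinearMap.exists_leftInverse_of_injective _ hker
  let L : (ι → ℂ) →L[ℂ] (Fin m' → ℂ) := LinearMap.toContinuousLinearMap L₀
  have hLk : HasStrictFDerivAt (fun u => L (k u))
      ((ContinuousLinearEquiv.refl ℂ (Fin m' → ℂ) : (Fin m' → ℂ) ≃L[ℂ] (Fin m' → ℂ)) :
        (Fin m' → ℂ) →L[ℂ] (Fin m' → ℂ)) (g w) := by
    have h := L.hasStrictFDerivAt.comp (g w) hk
    convert! h using 1
    ext1 t
    exact (LinearMap.congr_fun hL₀ t).symm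
  have hψ := hLk.to_localInverse.hasFDerivAt.differentiableAt
  have hAi : A w i ≠ 0 := by
    obtain ⟨r, hr, h⟩ := hAB.self_of_nhds
    rw [h]
    exact mul_ne_zero hr hi
  have hinner : DifferentiableAt ℂ (fun v => L ((A v i)⁻¹ • A v)) w :=
    L.differentiableAt.comp w (((differentiableAt_pi.1 hA i).fun_inv hAi).smul hA)
  have hnorm : ∀ᶠ v in 𝓝 w, (A v i)⁻¹ • A v = k (g v) := by
    filter_upwards [hAB] with v ⟨r, hr, h⟩
    rw [h, Pi.smul_apply, smul_eq_mul, mul_inv, smul_smul, mul_right_comm, inv_mul_cancel₀ hr,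
      one_mul]
  have hcomp := DifferentiableAt.comp w (g := hLk.localInverse _ _ _)
    (f := fun v => L ((A v i)⁻¹ • A v)) (by rw [hnorm.self_of_nhds]; exact hψ) hinner
  refine hcomp.congr_of_eventuallyEq ?_
  filter_upwards [hnorm, hg.eventually hLk.eventually_left_inverse] with v hv hv'
  rw [Function.comp_apply, hv, hv']

/-- The potential `-log Q` of a function `Q` which scales by `|r|²` changes by a pluriharmonic
function when its argument is multiplied by a holomorphic function. So the complex Hessians of the
potentials of two proportional maps `A` and `B ∘ g` correspond under pullback by `g`. -/
theorem complexHessian_of_proportional {Q : (ι → ℂ) → ℝ} (hQ : ContDiff ℝ ∞ Q)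
    (hQs : ∀ (r : ℂ) z, Q (r • z) = Complex.normSq r * Q z)
    {A : (Fin m → ℂ) → ι → ℂ} {B : (Fin m' → ℂ) → ι → ℂ}
    {g : (Fin m → ℂ) → Fin m' → ℂ} {w : Fin m → ℂ}
    (hA : ∀ᶠ v in 𝓝 w, DifferentiableAt ℂ A v)
    (hB : ∀ᶠ u in 𝓝 (g w), DifferentiableAt ℂ B u) (hg : ∀ᶠ v in 𝓝 w, DifferentiableAt ℂ g v)
    (hpos : 0 < Q (B (g w))) (hAB : ∀ᶠ v in 𝓝 w, ∃ r : ℂ, r ≠ 0 ∧ A v = r • B (g v)) :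
    complexHessian (fun v => -Real.log (Q (A v))) w = (jacobian g w).transpose *
      complexHessian (fun u => -Real.log (Q (B u))) (g w) * (jacobian g w).map (starRingEnd ℂ) := by
  have hB0 : B (g w) ≠ 0 := by
    intro h
    have := hQs 0 0
    rw [h] at hpos
    simp at this
    exact hpos.ne' this
  obtain ⟨i, hi⟩ := Function.ne_iff.1 hB0
  have hi : B (g w) i ≠ 0 := hi
  have hgw := hg.self_of_nhds
  have hgc := hgw.continuousAt
  have hBc := hB.self_of_nhds.continuousAt
  have hBg : ContinuousAt (fun v => B (g v)) w := ContinuousAt.comp (f := g) hBc hgc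
  have hBgi : ContinuousAt (fun v => B (g v) i) w := continuousAt_pi.1 hBg i
  -- the factor of proportionality is a quotient of coordinates, so it is holomorphic
  let l : (Fin m → ℂ) → ℂ := fun v => A v i * (B (g v) i)⁻¹
  have hl : ∀ᶠ v in 𝓝 w, DifferentiableAt ℂ l v := by
    filter_upwards [hA, hg, hgc.eventually hB, hBgi.eventually_ne hi] with v h1 h2 h3 h4
    have h5 : DifferentiableAt ℂ (fun v => B (g v) i) v :=
      (differentiableAt_pi.1 h3 i).comp v h2
    exact (differentiableAt_pi.1 h1 i).fun_mul (h5.fun_inv h4)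
  have hAl : ∀ᶠ v in 𝓝 w, l v ≠ 0 ∧ A v = l v • B (g v) := by
    filter_upwards [hAB, hBgi.eventually_ne hi] with v ⟨r, hr, h⟩ h4
    have : l v = r := by
      simp only [l, h, Pi.smul_apply, smul_eq_mul]
      field_simp
    rw [this]
    exact ⟨hr, h⟩
  have hKB : ContDiffAt ℝ ∞ (fun u => -Real.log (Q (B u))) (g w) := by
    refine ContDiffAt.neg (ContDiffAt.log ?_ hpos.ne')
    exact hQ.contDiffAt.comp _
      ((contDiffAt_of_eventually_differentiableAt hB).restrict_scalars ℝ)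
  have hgS : ContDiffAt ℝ ∞ g w :=
    (contDiffAt_of_eventually_differentiableAt hg).restrict_scalars ℝ
  have hlS : ContDiffAt ℝ ∞ (fun v => -Real.log (Complex.normSq (l v))) w := by
    have h : ContDiffAt ℝ ∞ l w :=
      (contDiffAt_of_eventually_differentiableAt hl).restrict_scalars ℝ
    refine ContDiffAt.neg (ContDiffAt.log ?_ (Complex.normSq_pos.2 hAl.self_of_nhds.1).ne')
    simp only [Complex.normSq_eq_norm_sq]
    exact h.norm_sq ℂ
  have hsum : (fun v => -Real.log (Q (A v))) =ᶠ[𝓝 w]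
      fun v => -Real.log (Complex.normSq (l v)) + -Real.log (Q (B (g v))) := by
    have hQB : ContinuousAt (fun v => Q (B (g v))) w := hQ.continuous.continuousAt.comp hBg
    filter_upwards [hAl, hQB.eventually_ne hpos.ne'] with v hv hv'
    rw [hv.2, hQs, Real.log_mul (Complex.normSq_pos.2 hv.1).ne' hv', neg_add]
  -- `-log |l|² = log |l⁻¹|²`
  have hlog : complexHessian (fun v => -Real.log (Complex.normSq (l v))) w = 0 := by
    have hinv : ∀ᶠ v in 𝓝 w, DifferentiableAt ℂ (fun v => (l v)⁻¹) v := by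
      filter_upwards [hl, hAl] with v h1 h2
      exact h1.fun_inv h2.1
    rw [← complexHessian_log_normSq hinv (inv_ne_zero hAl.self_of_nhds.1)]
    simp only [map_inv₀, Real.log_inv]
  have hKBg : ContDiffAt ℝ ∞ (fun v => -Real.log (Q (B (g v)))) w :=
    ContDiffAt.comp (g := fun u => -Real.log (Q (B u))) w hKB hgS
  rw [complexHessian_congr hsum, complexHessian_add hlS hKBg, hlog, zero_add]
  exact complexHessian_comp (K := fun u => -Real.log (Q (B u))) hKB hg

end ConeMaps

/-! ### Continuity of the action of autoequivalences -/

section WeilPeterssonForm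

variable {D : Type u} [Category.{v} D] [HasZeroObject D] [HasShift D ℤ] [Preadditive D]
  [∀ n : ℤ, (shiftFunctor D n).Additive] [Pretriangulated D] [Linear ℂ D] [FiniteType D]
  [∀ n : ℤ, (shiftFunctor D n).Linear ℂ]

namespace StabilityCondition

/-- An autoequivalence carries Harder--Narasimhan filtrations to Harder--Narasimhan filtrations. -/
theorem hnPhases_act_subset (Φ : ExactAuto D) (σ : StabilityCondition D) (X : D) :
    (act Φ σ).hnPhases X ⊆ σ.hnPhases (Φ.equiv.inverse.obj X) := by
  rintro t ⟨H, hA, i, rfl⟩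
  refine ⟨{ k := H.k
            E := fun i => Φ.equiv.inverse.obj (H.E i)
            A := fun i => Φ.equiv.inverse.obj (H.A i)
            φ := H.φ
            zero := Φ.equiv.inverse.map_isZero H.zero
            top := H.top.map fun e => Φ.equiv.inverse.mapIso e
            triangle := fun i => by
              obtain ⟨f, g, h, hT⟩ := H.triangle i
              exact ⟨_, _, _, Φ.equiv.inverse.map_distinguished _ hT⟩
            semistable := H.semistable
            anti := H.anti }, fun i h => hA i ?_, i, rfl⟩
  exact (Φ.equiv.functor.map_isZero h).of_iso (Φ.equiv.counitIso.app (H.A i)).symm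

theorem hnPhases_iso (σ : StabilityCondition D) {X Y : D} (e : X ≅ Y) :
    σ.hnPhases X ⊆ σ.hnPhases Y := by
  rintro t ⟨H, hA, i, rfl⟩
  exact ⟨{ H with top := H.top.map fun a => a ≪≫ e }, hA, i, rfl⟩

theorem hnPhases_act (Φ : ExactAuto D) (σ : StabilityCondition D) (X : D) :
    (act Φ σ).hnPhases X = σ.hnPhases (Φ.equiv.inverse.obj X) := by
  refine (hnPhases_act_subset Φ σ X).antisymm ?_
  have h := hnPhases_act_subset Φ.symm (act Φ σ) (Φ.equiv.inverse.obj X)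
  rw [act_symm] at h
  exact h.trans (hnPhases_iso _ (Φ.equiv.counitIso.app X))

theorem continuous_act (Φ : ExactAuto D) :
    Continuous (act Φ : StabilityCondition D → StabilityCondition D) := by
  refine continuous_inf_rng.2 ⟨continuous_induced_rng.2 ?_, continuous_induced_rng.2 ?_⟩
  · have h : Continuous fun σ : StabilityCondition D => (fun x : Num D => σ.Z x) :=
      continuous_iff_le_induced.2 inf_le_left
    exact continuous_pi fun x => (continuous_apply (Φ.symm.mapNum x)).comp h
  · have h : Continuous fun σ : StabilityCondition D => UniformFun.ofFun
        (fun X : {X : D // ¬ IsZero X} => (σ.phaseMinus X, σ.phasePlus X)) :=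
      continuous_iff_le_induced.2 inf_le_right
    let ψ : {X : D // ¬ IsZero X} → {X : D // ¬ IsZero X} := fun X =>
      ⟨Φ.equiv.inverse.obj X.1, fun h => X.2
        ((Φ.equiv.functor.map_isZero h).of_iso (Φ.equiv.counitIso.app X.1).symm)⟩
    have h' := (UniformFun.precomp_uniformContinuous (β := ℝ × ℝ) (f := ψ)).continuous.comp h
    refine h'.congr fun σ => ?_
    refine congrArg UniformFun.ofFun (funext fun X => ?_)
    simp only [phaseMinus, phasePlus, hnPhases_act]
    rfl

end StabilityCondition

variable {ι : Type*} [Fintype ι] [DecidableEq ι] {β : Module.Basis ι ℤ (Num D)} {n : ℕ}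

namespace StabPlus

theorem continuous_act (Φ : ExactAuto D) : Continuous (StabPlus.act (β := β) (n := n) Φ) :=
  ((StabilityCondition.continuous_act Φ).comp continuous_subtype_val).subtype_mk _

theorem charge_act (Φ : ExactAuto D) (σ : StabPlus β n) (i : ι) :
    (StabPlus.act Φ σ).charge i = ∑ k, (β.repr (Φ.symm.mapNum (β i)) k : ℂ) * σ.charge k := by
  show σ.1.Z (Φ.symm.mapNum (β i)) = _
  conv_lhs => rw [← β.sum_repr (Φ.symm.mapNum (β i))]
  simp only [map_sum, map_zsmul, zsmul_eq_mul]
  rfl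

end StabPlus

namespace ProjStab

theorem continuous_act (Φ : ExactAuto D) : Continuous (ProjStab.act (β := β) (n := n) Φ) :=
  (StabPlus.continuous_act Φ).quotient_map' _

theorem act_mk (Φ : ExactAuto D) (σ : StabPlus β n) :
    ProjStab.act Φ (ProjStab.mk σ) = ProjStab.mk (StabPlus.act Φ σ) := rfl

theorem act_refl (x : ProjStab β n) : ProjStab.act ExactAuto.refl x = x :=
  Quotient.inductionOn x fun σ =>
    congrArg ProjStab.mk (Subtype.ext (StabilityCondition.act_refl σ.1))

theorem act_symm_act (Φ : ExactAuto D) (x : ProjStab β n) :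
    ProjStab.act Φ.symm (ProjStab.act Φ x) = x :=
  Quotient.inductionOn x fun σ =>
    congrArg ProjStab.mk (Subtype.ext (StabilityCondition.act_symm Φ σ.1))

/-- Stability conditions in one `ℂ`-orbit have proportional central charges. -/
theorem charge_eq_smul_of_mk_eq {σ τ : StabPlus β n} (h : ProjStab.mk σ = ProjStab.mk τ) :
    ∃ r : ℂ, r ≠ 0 ∧ σ.charge = r • τ.charge := by
  obtain ⟨c, rfl⟩ : ∃ c : ℂ, c +ᵥ τ = σ := Quotient.exact h
  exact ⟨Complex.exp c, Complex.exp_ne_zero c, rfl⟩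

end ProjStab

/-! ### The potential as a function of the central charge -/

variable (β n) in
/-- The real number `(√-1)⁻ⁿ 𝔟(Z, Z̄)` as a function of the coordinates of `Z`. -/
def chargeNorm (z : ι → ℂ) : ℝ :=
  ((Complex.I ^ n)⁻¹ * ∑ i, ∑ j, (eulerMatrix β)⁻¹ i j * z i * starRingEnd ℂ (z j)).re

theorem contDiff_chargeNorm : ContDiff ℝ ∞ (chargeNorm β n) := by
  have h (i : ι) : ContDiff ℝ ∞ fun z : ι → ℂ => z i := contDiff_apply ℝ ℂ i
  have h' (i : ι) : ContDiff ℝ ∞ fun z : ι → ℂ => starRingEnd ℂ (z i) :=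
    Complex.conjCLE.contDiff.comp (h i)
  refine Complex.reCLM.contDiff.comp (contDiff_const.mul ?_)
  exact ContDiff.sum fun i _ => ContDiff.sum fun j _ => (contDiff_const.mul (h i)).mul (h' j)

theorem chargeNorm_smul (r : ℂ) (z : ι → ℂ) :
    chargeNorm β n (r • z) = Complex.normSq r * chargeNorm β n z := by
  rw [chargeNorm, chargeNorm, ← Complex.re_ofReal_mul, ← Complex.mul_conj]
  congr 1
  simp only [Finset.mul_sum]
  refine Finset.sum_congr rfl fun i _ => Finset.sum_congr rfl fun j _ => ?_
  simp only [Pi.smul_apply, smul_eq_mul, map_mul]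
  ring

theorem hermNorm_re (σ : StabPlus β n) :
    (hermNorm β n σ.1.Z).re = chargeNorm β n σ.charge := rfl

theorem chargeNorm_pos (σ : StabPlus β n) : 0 < chargeNorm β n σ.charge := σ.2.2.1

theorem chargeNorm_act (Φ : ExactAuto D) (σ : StabPlus β n) :
    chargeNorm β n (StabPlus.act Φ σ).charge = chargeNorm β n σ.charge := by
  rw [← hermNorm_re, ← hermNorm_re]
  exact congrArg Complex.re (hermNorm_act β n Φ σ.1)

theorem charge_ne_zero (σ : StabPlus β n) : σ.charge ≠ 0 := by
  intro h
  have h1 := chargeNorm_pos σ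
  rw [h] at h1
  simp [chargeNorm] at h1

/-- The potential `-log ((√-1)⁻ⁿ 𝔟(Z, Z̄))` of a family of stability conditions. -/
def liftPotential {T : Type*} (f : T → StabPlus β n) (t : T) : ℝ :=
  -Real.log (chargeNorm β n (f t).charge)

theorem contDiffAt_liftPotential {m : ℕ} {f : (Fin m → ℂ) → StabPlus β n} {w : Fin m → ℂ}
    (hf : ∀ᶠ v in 𝓝 w, DifferentiableAt ℂ (fun v => (f v).charge) v) :
    ContDiffAt ℝ ∞ (liftPotential f) w := by
  have h : ContDiffAt ℝ ∞ (fun v => (f v).charge) w :=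
    (contDiffAt_of_eventually_differentiableAt hf).restrict_scalars ℝ
  exact ((contDiff_chargeNorm.contDiffAt.comp w h).log (chargeNorm_pos _).ne').neg

/-! ### Holomorphic lifts of charts -/

/-- A holomorphic lift `f` to `Stab⁺_N(D)` of the inverse of a chart `c`, over the open set `V`. -/
structure IsLift {m : ℕ} (c : OpenPartialHomeomorph (ProjStab β n) (Fin m → ℂ))
    (V : Set (Fin m → ℂ)) (f : (Fin m → ℂ) → StabPlus β n) : Prop where
  isOpen : IsOpen V
  subset : V ⊆ c.target
  mk_eq : ∀ v ∈ V, ProjStab.mk (f v) = c.symm v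
  holomorphic : DifferentiableOn ℂ (fun v => (f v).charge) V

theorem IsLift.eventually {m : ℕ} {c : OpenPartialHomeomorph (ProjStab β n) (Fin m → ℂ)}
    {V : Set (Fin m → ℂ)} {f : (Fin m → ℂ) → StabPlus β n} (h : IsLift c V f) {w : Fin m → ℂ}
    (hw : w ∈ V) : ∀ᶠ v in 𝓝 w, DifferentiableAt ℂ (fun v => (f v).charge) v := by
  filter_upwards [h.isOpen.mem_nhds hw] with _ hv
  exact h.holomorphic.differentiableAt (h.isOpen.mem_nhds hv)

/-- A continuous holomorphic lift whose central charge is immersive modulo the tangent direction of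
the `ℂ`-orbits. -/
structure IsImmersedLift {m : ℕ} (c : OpenPartialHomeomorph (ProjStab β n) (Fin m → ℂ))
    (V : Set (Fin m → ℂ)) (f : (Fin m → ℂ) → StabPlus β n) : Prop extends IsLift c V f where
  continuousOn : ContinuousOn f V
  immersive : ∀ v ∈ V, ∀ t : Fin m → ℂ,
    (∃ r : ℂ, fderiv ℂ (fun u => (f u).charge) v t = r • (f v).charge) → t = 0

theorem exists_isImmersedLift {m : ℕ} {c : OpenPartialHomeomorph (ProjStab β n) (Fin m → ℂ)}
    (hc : c ∈ projCharts β n m) {w : Fin m → ℂ} (hw : w ∈ c.target) :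
    ∃ f V, IsImmersedLift c V f ∧ w ∈ V := by
  obtain ⟨V, hV, hwV, hVc, f, hf, hmk, hd, himm⟩ := hc w hw
  exact ⟨f, V, ⟨⟨hV, hVc, hmk, hd⟩, hf, himm⟩, hwV⟩

/-- A local section of the projection restricts to a lift of every chart. -/
theorem IsLocalSection.isLift {U : Set (ProjStab β n)} {s : ProjStab β n → StabPlus β n}
    (hs : IsLocalSection U s) {m : ℕ} {c : OpenPartialHomeomorph (ProjStab β n) (Fin m → ℂ)}
    (hc : c ∈ projCharts β n m) :
    IsLift c (c.target ∩ c.symm ⁻¹' U) (fun v => s (c.symm v)) where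
  isOpen := c.isOpen_inter_preimage_symm hs.isOpen
  subset := Set.inter_subset_left
  mk_eq _ hv := hs.mk_eq _ hv.2
  holomorphic := hs.holomorphic m c hc

section Pullback

variable {m m' : ℕ} {c : OpenPartialHomeomorph (ProjStab β n) (Fin m → ℂ)}
  {c' : OpenPartialHomeomorph (ProjStab β n) (Fin m' → ℂ)} {V : Set (Fin m → ℂ)}
  {V' : Set (Fin m' → ℂ)} {f : (Fin m → ℂ) → StabPlus β n} {f' : (Fin m' → ℂ) → StabPlus β n}

/-- An autoequivalence is holomorphic in charts and the Hessians of the potentials of lifts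
correspond under it, since the lifts agree up to the action of `ℂ`. -/
theorem IsLift.pullback (hf : IsLift c V f) (hf' : IsImmersedLift c' V' f') (Φ : ExactAuto D)
    {w : Fin m → ℂ} (hw : w ∈ V) (hs : ProjStab.act Φ (c.symm w) ∈ c'.source)
    (hw' : c' (ProjStab.act Φ (c.symm w)) ∈ V') :
    (∀ᶠ v in 𝓝 w, DifferentiableAt ℂ (fun v => c' (ProjStab.act Φ (c.symm v))) v) ∧
      complexHessian (liftPotential f) w =
        (jacobian (fun v => c' (ProjStab.act Φ (c.symm v))) w).transpose *
          complexHessian (liftPotential f') (c' (ProjStab.act Φ (c.symm w))) *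
          (jacobian (fun v => c' (ProjStab.act Φ (c.symm v))) w).map (starRingEnd ℂ) := by
  set g : (Fin m → ℂ) → Fin m' → ℂ := fun v => c' (ProjStab.act Φ (c.symm v)) with hg
  have hact : ∀ v ∈ V, ContinuousAt (fun v => ProjStab.act Φ (c.symm v)) v := fun v hv =>
    (ProjStab.continuous_act Φ).continuousAt.comp (c.continuousAt_symm (hf.subset hv))
  have hgc : ∀ v ∈ V, ProjStab.act Φ (c.symm v) ∈ c'.source → ContinuousAt g v :=
    fun v hv hv' => ContinuousAt.comp (f := fun v => ProjStab.act Φ (c.symm v))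
      (c'.continuousAt hv') (hact v hv)
  have hnhds : ∀ᶠ v in 𝓝 w,
      v ∈ V ∧ ProjStab.act Φ (c.symm v) ∈ c'.source ∧ g v ∈ V' :=
    (hf.isOpen.eventually_mem hw).and (((hact w hw).eventually
      (c'.open_source.eventually_mem hs)).and ((hgc w hw hs).eventually
        (hf'.isOpen.eventually_mem hw')))
  let A : (Fin m → ℂ) → ι → ℂ := fun v => (StabPlus.act Φ (f v)).charge
  let B : (Fin m' → ℂ) → ι → ℂ := fun u => (f' u).charge
  have hA : ∀ᶠ v in 𝓝 w, DifferentiableAt ℂ A v := by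
    filter_upwards [hf.eventually hw] with v hv
    refine differentiableAt_pi.2 fun i => ?_
    simp only [A, StabPlus.charge_act]
    exact DifferentiableAt.fun_sum fun k _ => (differentiableAt_pi.1 hv k).const_mul _
  have hAB : ∀ᶠ v in 𝓝 w, ∃ r : ℂ, r ≠ 0 ∧ A v = r • B (g v) := by
    filter_upwards [hnhds] with v ⟨h1, h2, h3⟩
    refine ProjStab.charge_eq_smul_of_mk_eq ?_
    rw [← ProjStab.act_mk, hf.mk_eq v h1, hf'.mk_eq _ h3, hg, c'.left_inv h2]
  have hgd : ∀ᶠ v in 𝓝 w, DifferentiableAt ℂ g v := by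
    filter_upwards [hnhds, hA, hAB.eventually_nhds] with v ⟨h1, h2, h3⟩ h4 h5
    exact differentiableAt_of_proportional h4 (hf'.eventually h3) (hgc v h1 h2)
      (charge_ne_zero _) (hf'.immersive _ h3) h5
  refine ⟨hgd, ?_⟩
  have h := complexHessian_of_proportional (contDiff_chargeNorm (β := β) (n := n))
    chargeNorm_smul hA (hf'.eventually hw') hgd (chargeNorm_pos _) hAB
  simp only [A, chargeNorm_act] at h
  exact h

theorem jacobian_congr {g g' : (Fin m → ℂ) → Fin m' → ℂ} {w : Fin m → ℂ} (h : g =ᶠ[𝓝 w] g') :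
    jacobian g w = jacobian g' w := by
  rw [jacobian, jacobian, h.fderiv_eq]

theorem jacobian_id (w : Fin m → ℂ) : jacobian (fun v => v) w = 1 := by
  ext i j
  simp [jacobian, Matrix.one_apply, Pi.single_apply]

theorem IsLift.complexHessian_eq {V' : Set (Fin m → ℂ)} {f' : (Fin m → ℂ) → StabPlus β n}
    (hf : IsLift c V f) (hf' : IsImmersedLift c V' f') {w : Fin m → ℂ} (hw : w ∈ V)
    (hw' : w ∈ V') : complexHessian (liftPotential f) w = complexHessian (liftPotential f') w := by
  have hid : (fun v => c (ProjStab.act ExactAuto.refl (c.symm v))) =ᶠ[𝓝 w] fun v => v := by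
    filter_upwards [c.open_target.mem_nhds (hf.subset hw)] with v hv
    rw [ProjStab.act_refl, c.right_inv hv]
  have hid_w : c (ProjStab.act ExactAuto.refl (c.symm w)) = w := hid.self_of_nhds
  have h := (hf.pullback hf' ExactAuto.refl hw
    (by rw [ProjStab.act_refl]; exact c.map_target (hf.subset hw)) (by rwa [hid_w])).2
  rw [jacobian_congr hid, jacobian_id, hid_w] at h
  simpa using h

end Pullback

/-! ### The Weil--Petersson form on `Stab⁺_N(D)/ℂ` -/

/-- The coefficients in a chart of the Weil--Petersson form: the complex Hessian of the potential of
some lift near the given point. -/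
def weilPeterssonCoeff : Coefficients (projCharts β n) := fun _ c hc w =>
  open Classical in
  if hw : w ∈ c.target then complexHessian (liftPotential (exists_isImmersedLift hc hw).choose) w
  else 0

theorem weilPeterssonCoeff_eq {m : ℕ} {c : OpenPartialHomeomorph (ProjStab β n) (Fin m → ℂ)}
    (hc : c ∈ projCharts β n m) {V : Set (Fin m → ℂ)} {f : (Fin m → ℂ) → StabPlus β n}
    (hf : IsLift c V f) {w : Fin m → ℂ} (hw : w ∈ V) :
    weilPeterssonCoeff m c hc w = complexHessian (liftPotential f) w := by
  rw [weilPeterssonCoeff, dif_pos (hf.subset hw)]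
  obtain ⟨V', hf', hw'⟩ := (exists_isImmersedLift hc (hf.subset hw)).choose_spec
  exact (hf.complexHessian_eq hf' hw hw').symm

theorem weilPeterssonCoeff_isPullbackAt_act (Φ : ExactAuto D) (x : ProjStab β n) :
    IsPullbackAt (ProjStab.act Φ) weilPeterssonCoeff weilPeterssonCoeff x := by
  intro m m' c c' hc hc' hx hx'
  obtain ⟨f, V, hf, hw⟩ := exists_isImmersedLift hc (c.map_source hx)
  obtain ⟨f', V', hf', hw'⟩ := exists_isImmersedLift hc' (c'.map_source hx')
  have hx₀ := c.left_inv hx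
  have h := hf.toIsLift.pullback hf' Φ hw (by rwa [hx₀]) (by rwa [hx₀])
  rw [weilPeterssonCoeff_eq hc hf.toIsLift hw, weilPeterssonCoeff_eq hc' hf'.toIsLift hw']
  refine ⟨h.1.self_of_nhds, ?_⟩
  rw [h.2, hx₀]

variable (β n) in
/-- The Weil--Petersson form on `Stab⁺_N(D)/ℂ`. -/
def weilPetersson : OneOneForm (projCharts β n) where
  coeff := weilPeterssonCoeff
  eq_zero m c hc w hw := dif_neg hw
  smooth m c hc j k w hw := by
    obtain ⟨f, V, hf, hwV⟩ := exists_isImmersedLift hc hw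
    have h := contDiffAt_complexHessian (contDiffAt_liftPotential (hf.eventually hwV)) j k
    refine (h.congr_of_eventuallyEq ?_).contDiffWithinAt
    filter_upwards [hf.isOpen.mem_nhds hwV] with v hv
    rw [weilPeterssonCoeff_eq hc hf.toIsLift hv]
  compatible x := by
    have h := weilPeterssonCoeff_isPullbackAt_act ExactAuto.refl x
    rwa [show ProjStab.act (β := β) (n := n) ExactAuto.refl = id from
      funext ProjStab.act_refl] at h

theorem weilPetersson_isHessianOn {U : Set (ProjStab β n)} {s : ProjStab β n → StabPlus β n}
    (hs : IsLocalSection U s) : (weilPetersson β n).IsHessianOn U (potential s) :=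
  fun _ _ hc _ hw hU => weilPeterssonCoeff_eq hc (hs.isLift hc) ⟨hw, hU⟩

/-- A lift of a chart, read as a function on the quotient, is a local holomorphic section: its
central charge is holomorphic in the other charts since changes of charts are holomorphic. -/
theorem IsImmersedLift.isLocalSection {m : ℕ}
    {c : OpenPartialHomeomorph (ProjStab β n) (Fin m → ℂ)} (hc : c ∈ projCharts β n m)
    {V : Set (Fin m → ℂ)} {f : (Fin m → ℂ) → StabPlus β n} (hf : IsImmersedLift c V f) :
    IsLocalSection (c.source ∩ c ⁻¹' V) (fun x => f (c x)) where
  isOpen := c.isOpen_inter_preimage hf.isOpen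
  continuousOn := hf.continuousOn.comp (c.continuousOn.mono Set.inter_subset_left)
    fun _ hx => hx.2
  mk_eq x hx := by rw [hf.mk_eq _ hx.2, c.left_inv hx.1]
  holomorphic m' c' hc' w hw := by
    have h := ((weilPetersson β n).compatible (c'.symm w) m' m c' c hc' hc
      (c'.map_target hw.1) hw.2.1).1
    rw [c'.right_inv hw.1] at h
    exact (DifferentiableAt.comp w (f := fun v => c (c'.symm v))
      (hf.holomorphic.differentiableAt (hf.isOpen.mem_nhds hw.2.2)) h).differentiableWithinAt

/-- The Weil--Petersson form is the only form which is the Hessian of the potential of every local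
section, since there are local sections through every point in the domain of a chart. -/
theorem eq_weilPetersson {η : OneOneForm (projCharts β n)}
    (h : ∀ U s, IsLocalSection U s → η.IsHessianOn U (potential s)) : η = weilPetersson β n := by
  refine OneOneForm.ext (funext fun m => funext fun c => funext fun hc => funext fun w => ?_)
  by_cases hw : w ∈ c.target
  · obtain ⟨f, V, hf, hwV⟩ := exists_isImmersedLift hc hw
    have hs := hf.isLocalSection hc
    have hU : c.symm w ∈ c.source ∩ c ⁻¹' V :=
      ⟨c.map_target hw, by rwa [Set.mem_preimage, c.right_inv hw]⟩
    rw [h _ _ hs m c hc w hw hU, weilPetersson_isHessianOn hs m c hc w hw hU]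
  · rw [η.eq_zero m c hc w hw, (weilPetersson β n).eq_zero m c hc w hw]

end WeilPeterssonForm

/-! ### Descent to the double quotient -/

section Descent

variable {D : Type u} [Category.{v} D] [HasZeroObject D] [HasShift D ℤ] [Preadditive D]
  [∀ n : ℤ, (shiftFunctor D n).Additive] [Pretriangulated D] [Linear ℂ D] [FiniteType D]
  [∀ n : ℤ, (shiftFunctor D n).Linear ℂ]
  {ι : Type*} [Fintype ι] [DecidableEq ι] {β : Module.Basis ι ℤ (Num D)} {n : ℕ}

namespace DoubleQuot

theorem continuous_mk : Continuous (DoubleQuot.mk : ProjStab β n → DoubleQuot β n) :=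
  continuous_quotient_mk'

theorem mk_act (Φ : ExactAuto D) (x : ProjStab β n) :
    DoubleQuot.mk (ProjStab.act Φ x) = DoubleQuot.mk x :=
  (Quotient.sound ⟨Φ, rfl⟩ : DoubleQuot.mk x = DoubleQuot.mk (ProjStab.act Φ x)).symm

theorem exists_act_eq {x y : ProjStab β n} (h : DoubleQuot.mk x = DoubleQuot.mk y) :
    ∃ Φ : ExactAuto D, ProjStab.act Φ x = y :=
  Quotient.exact h

/-- The projection is injective near every point over the regular locus, not only near one point of
each fibre, because `Aut(D)` acts transitively on the fibres by homeomorphisms. -/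
theorem exists_injOn_nhds {x : ProjStab β n} (hx : DoubleQuot.mk x ∈ regularLocus β n) :
    ∃ V ∈ 𝓝 x, Set.InjOn (DoubleQuot.mk : ProjStab β n → DoubleQuot β n) V := by
  obtain ⟨y, ⟨V, hV, hinj⟩, hy⟩ := hx
  obtain ⟨Φ, rfl⟩ := exists_act_eq hy.symm
  refine ⟨ProjStab.act Φ ⁻¹' V, (ProjStab.continuous_act Φ).continuousAt hV, ?_⟩
  intro a ha b hb hab
  have h := hinj ha hb (by rw [mk_act, mk_act, hab])
  rw [← ProjStab.act_symm_act Φ a, h, ProjStab.act_symm_act]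

/-- Two continuous lifts of a map to the double quotient that agree at a point over the regular
locus agree nearby. -/
theorem eventuallyEq_of_mk_eq {T : Type*} [TopologicalSpace T] {p q : T → ProjStab β n} {t : T}
    (hp : ContinuousAt p t) (hq : ContinuousAt q t) (hpq : p t = q t)
    (hreg : DoubleQuot.mk (p t) ∈ regularLocus β n)
    (h : ∀ᶠ s in 𝓝 t, DoubleQuot.mk (p s) = DoubleQuot.mk (q s)) : p =ᶠ[𝓝 t] q := by
  obtain ⟨V, hV, hinj⟩ := exists_injOn_nhds hreg
  filter_upwards [hp.eventually hV, hq.eventually (hpq ▸ hV), h] with s h1 h2 h3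
  exact hinj h1 h2 h3

end DoubleQuot

variable {η : OneOneForm (projCharts β n)}

/-- An invariant form on `Stab⁺_N(D)/ℂ` is compatible with all continuous maps between charts that
cover the identity of the regular locus: such maps are given locally by autoequivalences. -/
theorem OneOneForm.pullback_of_mk_eq
    (hη : ∀ (Φ : ExactAuto D) x, IsPullbackAt (ProjStab.act Φ) η.coeff η.coeff x)
    {m m' : ℕ} {c : OpenPartialHomeomorph (ProjStab β n) (Fin m → ℂ)}
    {c' : OpenPartialHomeomorph (ProjStab β n) (Fin m' → ℂ)} (hc : c ∈ projCharts β n m)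
    (hc' : c' ∈ projCharts β n m') {g : (Fin m → ℂ) → Fin m' → ℂ} {w : Fin m → ℂ}
    (hw : w ∈ c.target) (hw' : g w ∈ c'.target) (hg : ContinuousAt g w)
    (hreg : DoubleQuot.mk (c.symm w) ∈ regularLocus β n)
    (h : ∀ᶠ v in 𝓝 w, DoubleQuot.mk (c'.symm (g v)) = DoubleQuot.mk (c.symm v)) :
    DifferentiableAt ℂ g w ∧ η.coeff m c hc w = (jacobian g w).transpose *
      η.coeff m' c' hc' (g w) * (jacobian g w).map (starRingEnd ℂ) := by
  obtain ⟨Φ, hΦ⟩ := DoubleQuot.exists_act_eq h.self_of_nhds.symm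
  have hlift : (fun v => ProjStab.act Φ (c.symm v)) =ᶠ[𝓝 w] fun v => c'.symm (g v) := by
    refine DoubleQuot.eventuallyEq_of_mk_eq
      ((ProjStab.continuous_act Φ).continuousAt.comp (c.continuousAt_symm hw))
      (ContinuousAt.comp (f := g) (c'.continuousAt_symm hw') hg) hΦ
      (by rwa [DoubleQuot.mk_act]) ?_
    filter_upwards [h] with v hv
    rw [DoubleQuot.mk_act, hv]
  have hgΦ : (fun v => c' (ProjStab.act Φ (c.symm v))) =ᶠ[𝓝 w] g := by
    filter_upwards [hlift, hg.eventually (c'.open_target.eventually_mem hw')] with v hv hv'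
    rw [hv, c'.right_inv hv']
  have key := hη Φ (c.symm w) m m' c c' hc hc' (c.map_target hw)
    (by rw [hΦ]; exact c'.map_target hw')
  rw [c.right_inv hw, jacobian_congr hgΦ, hΦ, c'.right_inv hw'] at key
  exact ⟨key.1.congr_of_eventuallyEq hgΦ.symm, key.2⟩

theorem OneOneForm.coeff_eq_of_mk_eq
    (hη : ∀ (Φ : ExactAuto D) x, IsPullbackAt (ProjStab.act Φ) η.coeff η.coeff x)
    {m : ℕ} {c c' : OpenPartialHomeomorph (ProjStab β n) (Fin m → ℂ)} (hc : c ∈ projCharts β n m)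
    (hc' : c' ∈ projCharts β n m) {w : Fin m → ℂ} (hw : w ∈ c.target) (hw' : w ∈ c'.target)
    (hreg : DoubleQuot.mk (c.symm w) ∈ regularLocus β n)
    (h : ∀ᶠ v in 𝓝 w, DoubleQuot.mk (c'.symm v) = DoubleQuot.mk (c.symm v)) :
    η.coeff m c hc w = η.coeff m c' hc' w := by
  have key := (OneOneForm.pullback_of_mk_eq hη hc hc' (g := fun v => v) hw hw' continuousAt_id
    hreg h).2
  rw [jacobian_id] at key
  simpa using key

/-- A chart `c'` of `Stab⁺_N(D)/ℂ` near `w` is a local lift of the chart `c` of the double quotient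
if the projection is the identity in these charts. -/
structure IsChartLift {m : ℕ} (c : OpenPartialHomeomorph (DoubleQuot β n) (Fin m → ℂ))
    (w : Fin m → ℂ) (c' : OpenPartialHomeomorph (ProjStab β n) (Fin m → ℂ)) : Prop where
  mem_projCharts : c' ∈ projCharts β n m
  mem_target : w ∈ c'.target
  target_subset : c'.target ⊆ c.target
  symm_eq : ∀ v ∈ c'.target, c.symm v = DoubleQuot.mk (c'.symm v)

theorem exists_isChartLift {m : ℕ} {c : OpenPartialHomeomorph (DoubleQuot β n) (Fin m → ℂ)}
    (hc : c ∈ doubleCharts β n m) {w : Fin m → ℂ} (hw : w ∈ c.target) :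
    ∃ c', IsChartLift c w c' := by
  obtain ⟨c', h1, h2, h3, h4⟩ := hc.2 w hw
  exact ⟨c', h1, h2, h3, h4⟩

section ChartLift

variable {m : ℕ} {c : OpenPartialHomeomorph (DoubleQuot β n) (Fin m → ℂ)} {w : Fin m → ℂ}
  {c' : OpenPartialHomeomorph (ProjStab β n) (Fin m → ℂ)}

theorem IsChartLift.eventually (h : IsChartLift c w c') :
    ∀ᶠ v in 𝓝 w, IsChartLift c v c' := by
  filter_upwards [c'.open_target.mem_nhds h.mem_target] with v hv
  exact { h with mem_target := hv }

theorem IsChartLift.mk_symm (h : IsChartLift c w c') : DoubleQuot.mk (c'.symm w) = c.symm w :=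
  (h.symm_eq w h.mem_target).symm

theorem IsChartLift.mk_symm_mem_regularLocus (h : IsChartLift c w c')
    (hc : c ∈ doubleCharts β n m) : DoubleQuot.mk (c'.symm w) ∈ regularLocus β n := by
  rw [h.mk_symm]
  exact hc.1 (c.map_target (h.target_subset h.mem_target))

end ChartLift

variable (η) in
/-- The coefficients of the form on the regular locus induced by an invariant form `η`: those of `η`
in a local lift of the given chart. -/
def OneOneForm.descendCoeff : Coefficients (doubleCharts β n) := fun m _ hc w =>
  open Classical in
  if hw : w ∈ _ then η.coeff m _ (exists_isChartLift hc hw).choose_spec.mem_projCharts w else 0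

theorem OneOneForm.descendCoeff_eq
    (hη : ∀ (Φ : ExactAuto D) x, IsPullbackAt (ProjStab.act Φ) η.coeff η.coeff x)
    {m : ℕ} {c : OpenPartialHomeomorph (DoubleQuot β n) (Fin m → ℂ)} (hc : c ∈ doubleCharts β n m)
    {w : Fin m → ℂ} {c' : OpenPartialHomeomorph (ProjStab β n) (Fin m → ℂ)}
    (h : IsChartLift c w c') :
    η.descendCoeff m c hc w = η.coeff m c' h.mem_projCharts w := by
  have hw := h.target_subset h.mem_target
  rw [descendCoeff, dif_pos hw]
  have h' := (exists_isChartLift hc hw).choose_spec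
  refine coeff_eq_of_mk_eq hη _ _ h'.mem_target h.mem_target (h'.mk_symm_mem_regularLocus hc) ?_
  filter_upwards [h.eventually, h'.eventually] with v h1 h2
  rw [h1.mk_symm, h2.mk_symm]

/-- The form induced on the regular locus of the double quotient by an invariant form. -/
def OneOneForm.descend (η : OneOneForm (projCharts β n))
    (hη : ∀ (Φ : ExactAuto D) x, IsPullbackAt (ProjStab.act Φ) η.coeff η.coeff x) :
    OneOneForm (doubleCharts β n) where
  coeff := η.descendCoeff
  eq_zero m c hc w hw := dif_neg hw
  smooth m c hc j k w hw := by
    obtain ⟨c', h⟩ := exists_isChartLift hc hw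
    have hs := (η.smooth m c' h.mem_projCharts j k).contDiffAt
      (c'.open_target.mem_nhds h.mem_target)
    refine (hs.congr_of_eventuallyEq ?_).contDiffWithinAt
    filter_upwards [h.eventually] with v hv
    rw [descendCoeff_eq hη hc hv]
  compatible y := by
    intro m₁ m₂ c₁ c₂ hc₁ hc₂ hy₁ hy₂
    simp only [id_eq] at hy₂ ⊢
    obtain ⟨c₁', h₁⟩ := exists_isChartLift hc₁ (c₁.map_source hy₁)
    obtain ⟨c₂', h₂⟩ := exists_isChartLift hc₂ (c₂.map_source hy₂)
    have hy : c₁.symm (c₁ y) = y := c₁.left_inv hy₁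
    have hgw : c₂ (c₁.symm (c₁ y)) = c₂ y := by rw [hy]
    have hsymm : ContinuousAt c₁.symm (c₁ y) := c₁.continuousAt_symm (c₁.map_source hy₁)
    have hg : ContinuousAt (fun v => c₂ (c₁.symm v)) (c₁ y) :=
      ContinuousAt.comp (f := c₁.symm) (c₂.continuousAt (by rwa [hy])) hsymm
    have key := pullback_of_mk_eq hη h₁.mem_projCharts h₂.mem_projCharts h₁.mem_target
      (by rw [hgw]; exact h₂.mem_target) hg (h₁.mk_symm_mem_regularLocus hc₁) ?_
    · rw [descendCoeff_eq hη hc₁ h₁, descendCoeff_eq hη hc₂ h₂]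
      rw [hgw] at key
      exact key
    · have h₂e := h₂.eventually
      rw [← hgw] at h₂e
      filter_upwards [h₁.eventually, hg.eventually h₂e,
        hsymm.eventually (c₂.open_source.eventually_mem (by rwa [hy]))] with v hv hv' hv''
      rw [hv.mk_symm, hv'.mk_symm, c₂.left_inv hv'']

theorem OneOneForm.descend_coeff_eq
    (hη : ∀ (Φ : ExactAuto D) x, IsPullbackAt (ProjStab.act Φ) η.coeff η.coeff x)
    {m : ℕ} {c : OpenPartialHomeomorph (DoubleQuot β n) (Fin m → ℂ)} (hc : c ∈ doubleCharts β n m)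
    {w : Fin m → ℂ} {c' : OpenPartialHomeomorph (ProjStab β n) (Fin m → ℂ)}
    (h : IsChartLift c w c') :
    (η.descend hη).coeff m c hc w = η.coeff m c' h.mem_projCharts w :=
  descendCoeff_eq hη hc h

theorem OneOneForm.descend_isPullbackAt
    (hη : ∀ (Φ : ExactAuto D) x, IsPullbackAt (ProjStab.act Φ) η.coeff η.coeff x)
    {x : ProjStab β n} (hx : DoubleQuot.mk x ∈ regularLocus β n) :
    IsPullbackAt DoubleQuot.mk (η.descend hη).coeff η.coeff x := by
  intro m m' c d hc hd hxc hxd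
  obtain ⟨c', h⟩ := exists_isChartLift hd (d.map_source hxd)
  have hx₀ : c.symm (c x) = x := c.left_inv hxc
  have hgw : d (DoubleQuot.mk (c.symm (c x))) = d (DoubleQuot.mk x) := by rw [hx₀]
  have hmk : ContinuousAt (fun v => DoubleQuot.mk (c.symm v)) (c x) :=
    DoubleQuot.continuous_mk.continuousAt.comp (c.continuousAt_symm (c.map_source hxc))
  have hg : ContinuousAt (fun v => d (DoubleQuot.mk (c.symm v))) (c x) :=
    ContinuousAt.comp (f := fun v => DoubleQuot.mk (c.symm v)) (d.continuousAt (by rwa [hx₀])) hmk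
  have key := pullback_of_mk_eq hη hc h.mem_projCharts (c.map_source hxc)
    (by rw [hgw]; exact h.mem_target) hg (by rwa [hx₀]) ?_
  · rw [descend_coeff_eq hη hd h]
    rw [hgw] at key
    exact key
  · have he := h.eventually
    rw [← hgw] at he
    filter_upwards [hg.eventually he,
      hmk.eventually (d.open_source.eventually_mem (by simpa only [hx₀] using hxd))] with v hv hv'
    rw [hv.mk_symm, d.left_inv hv']

/-- A form on the regular locus is determined by its pullback to `Stab⁺_N(D)/ℂ`, because the
projection is the identity in a chart and its local lifts. -/
theorem OneOneForm.eq_descend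
    (hη : ∀ (Φ : ExactAuto D) x, IsPullbackAt (ProjStab.act Φ) η.coeff η.coeff x)
    {η₁ : OneOneForm (doubleCharts β n)}
    (h₁ : ∀ x : ProjStab β n, DoubleQuot.mk x ∈ regularLocus β n →
      IsPullbackAt DoubleQuot.mk η₁.coeff η.coeff x) : η₁ = η.descend hη := by
  refine OneOneForm.ext (funext fun m => funext fun c => funext fun hc => funext fun w => ?_)
  by_cases hw : w ∈ c.target
  · obtain ⟨c', h⟩ := exists_isChartLift hc hw
    have hid : (fun v => c (DoubleQuot.mk (c'.symm v))) =ᶠ[𝓝 w] fun v => v := by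
      filter_upwards [h.eventually] with v hv
      rw [hv.mk_symm, c.right_inv (hv.target_subset hv.mem_target)]
    have key := (h₁ (c'.symm w) (h.mk_symm_mem_regularLocus hc) m m c' c h.mem_projCharts hc
      (c'.map_target h.mem_target) (by rw [h.mk_symm]; exact c.map_target hw)).2
    rw [c'.right_inv h.mem_target, jacobian_congr hid, jacobian_id, h.mk_symm,
      c.right_inv hw] at key
    rw [descend_coeff_eq hη hc h, key]
    simp
  · rw [η₁.eq_zero m c hc w hw, (η.descend hη).eq_zero m c hc w hw]

end Descent

end

end StabWP

theorem mainTheorem9 {D : Type u} [Category.{v} D] [HasZeroObject D] [HasShift D ℤ]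
    [Preadditive D] [∀ n : ℤ, (shiftFunctor D n).Additive] [Pretriangulated D] [IsTriangulated D]
    [Linear ℂ D] [∀ n : ℤ, (shiftFunctor D n).Linear ℂ] [StabWP.FiniteType D]
    (n : ℕ) (_hCY : StabWP.IsCalabiYau D n)
    {ι : Type*} [Fintype ι] [DecidableEq ι] (β : Module.Basis ι ℤ (StabWP.Num D)) :
    -- the potential of a local holomorphic section is smooth
    (∀ U s, StabWP.IsLocalSection (β := β) (n := n) U s →
      ∀ m, ∀ c ∈ StabWP.projCharts β n m,
        ContDiffOn ℝ ∞ (fun v => StabWP.potential s (c.symm v)) (c.target ∩ c.symm ⁻¹' U)) ∧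
    -- its complex Hessian does not depend on the section
    (∀ U s U' s', StabWP.IsLocalSection (β := β) (n := n) U s →
      StabWP.IsLocalSection (β := β) (n := n) U' s' →
      ∀ m, ∀ c ∈ StabWP.projCharts β n m, ∀ w ∈ c.target, c.symm w ∈ U ∩ U' →
        StabWP.complexHessian (fun v => StabWP.potential s (c.symm v)) w =
          StabWP.complexHessian (fun v => StabWP.potential s' (c.symm v)) w) ∧
    -- the complex Hessians define one global form `η` on the quotient by `ℂ`
    ∃ η : StabWP.OneOneForm (StabWP.projCharts β n),
      (∀ U s, StabWP.IsLocalSection U s → η.IsHessianOn U (StabWP.potential s)) ∧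
      (∀ η' : StabWP.OneOneForm (StabWP.projCharts β n),
        (∀ U s, StabWP.IsLocalSection U s → η'.IsHessianOn U (StabWP.potential s)) → η' = η) ∧
      -- the form is invariant under autoequivalences
      (∀ (Φ : StabWP.ExactAuto D) (x : StabWP.ProjStab β n),
        StabWP.IsPullbackAt (StabWP.ProjStab.act Φ) η.coeff η.coeff x) ∧
      -- and it descends to the double quotient away from the singular locus
      ∃! η₀ : StabWP.OneOneForm (StabWP.doubleCharts β n),
        ∀ x : StabWP.ProjStab β n, StabWP.DoubleQuot.mk x ∈ StabWP.regularLocus β n →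
          StabWP.IsPullbackAt StabWP.DoubleQuot.mk η₀.coeff η.coeff x := by
  have hinv : ∀ (Φ : StabWP.ExactAuto D) (x : StabWP.ProjStab β n), StabWP.IsPullbackAt
      (StabWP.ProjStab.act Φ) (StabWP.weilPetersson β n).coeff (StabWP.weilPetersson β n).coeff x :=
    StabWP.weilPeterssonCoeff_isPullbackAt_act
  refine ⟨fun U s hs m c hc w hw => ?_, fun U s U' s' hs hs' m c hc w hw hU => ?_,
    StabWP.weilPetersson β n, fun U s hs => StabWP.weilPetersson_isHessianOn hs,
    fun η' h => StabWP.eq_weilPetersson h, hinv, (StabWP.weilPetersson β n).descend hinv,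
    fun x hx => StabWP.OneOneForm.descend_isPullbackAt hinv hx,
    fun η₁ h₁ => StabWP.OneOneForm.eq_descend hinv h₁⟩
  · exact (StabWP.contDiffAt_liftPotential ((hs.isLift hc).eventually hw)).contDiffWithinAt
  · exact (StabWP.weilPetersson_isHessianOn hs m c hc w hw hU.1).symm.trans
      (StabWP.weilPetersson_isHessianOn hs' m c hc w hw hU.2)
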